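/- Let $W$ be a finite-dimensional real or complex vector space with an inner product (Hermitian if $W$ is complex), and let $Gr_p(W)$ be the Grassmannian of oriented $p$-planes in $W$ in the real case and of complex $p$-planes in $W$ in the complex case. Let $S\to Gr_p(W)$ be the tautological bundle and $Q\to Gr_p(W)$ the universal quotient bundle, identified with $S^{\perp}$ inside the trivial bundle $\underline W$, and let $\pi_S,\pi_Q$ be the orthogonal projections of $\underline W$ onto $S$ and $Q$. Equip $S$ and $Q$ with the induced fibre metrics, $Q$ with the canonical connection $\nabla^Q t=\pi_Q(dt)$, and $Gr_p(W)$ with the Riemannian metric of Fubini–Study type, i.e. the metric $g_S\otimes g_Q$ on $T\,Gr_p(W)=\mathrm{Hom}(S,Q)$: $g(X,Y)=\mathrm{Re}\sum_j (Xs_j,Ys_j)$ for an orthonormal basis $(s_j)$ of the fibre of $S$. The second fundamental forms $H\in\Omega^1(\mathrm{Hom}(S,Q))$ and $K\in\Omega^1(\mathrm{Hom}(Q,S))$ are defined by $H(s)=\pi_Q(ds)$ and $K(t)=\pi_S(dt)$ for local sections $s$ of $S$ and $t$ of $Q$. Let $(M,g)$ be an $n$-dimensional Riemannian manifold and $f:M\to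 Gr_p(W)$ a smooth map. Let $V=f^*Q\to M$ carry the pulled-back metric and connection $\nabla$, and let $$\Delta=\nabla^*\nabla=-\sum_{i=1}^n(\nabla_{e_i}\nabla)(e_i),\qquad A=\sum_{i=1}^n H_{df(e_i)}K_{df(e_i)}\in\Gamma(\mathrm{End}\,V),\qquad e(f)=\sum_{i=1}^n|df(e_i)|^2$$ be the Laplace operator on sections of $V$, the mean curvature operator of $f$ and the energy density of $f$, where $(e_i)$ is an orthonormal basis of the tangent space of $M$. Each $w\in W$ defines the section $x\mapsto\pi_Q(w)_{f(x)}$ of $V$; in this way $W$ is regarded as a space of sections of $V$. For a section $t$ let $Z_t=\{x\in M: t(x)=0\}$. Then the following two conditions are equivalent: 1. $f$ is a harmonic map, i.e. its tension field $\tau(f)=\mathrm{trace}\,\nabla df$ vanishes identically. 2. $W$ has the zero property for the Laplacian, i.e. $Z_t\subset Z_{\Delta t}$ for every $t\in W$. Under these conditions, $\Delta t=-At$ for every $t\in W$, and $e(f)=-\mathrm{trace}\,A$ (the trace being taken over the ground field $\mathbb R$ or $\mathbb C$ of $W$). -/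

import Mathlib

open Bundle
open scoped Manifold ContDiff Topology

/-! ### Harmonic maps between Riemannian manifolds -/

section Harmonic

variable {E : Type*} [NormedAddCommGroup E] [NormedSpace ℝ E]
  {H : Type*} [TopologicalSpace H] (I : ModelWithCorners ℝ E H)
  {M : Type*} [TopologicalSpace M] [ChartedSpace H M] [IsManifold I ∞ M]

/-- The coordinate vector field `∂_v` of the preferred chart at `x`, with `∂_v(x) = v`. -/
noncomputable def coordField (x : M) (v : TangentSpace I x) (y : M) : TangentSpace I y :=
  (trivializationAt E (TangentSpace I : M → Type _) x).symmL ℝ y v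

variable [RiemannianBundle (fun x : M => TangentSpace I x)]

/-- The derivative `∂_u ⟪∂_v, ∂_w⟫` at `x` of a coefficient of the metric in the preferred chart
at `x`. -/
noncomputable def metricDeriv (x : M) (u v w : TangentSpace I x) : ℝ :=
  mfderiv I 𝓘(ℝ, ℝ) (fun y => inner ℝ (coordField I x v y) (coordField I x w y)) x u

variable [FiniteDimensional ℝ E]

instance (x : M) : FiniteDimensional ℝ (TangentSpace I x) :=
  inferInstanceAs (FiniteDimensional ℝ E)

/-- The Levi-Civita covariant derivative `∇_u ∂_v` at `x` of a coordinate vector field of the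
preferred chart at `x` (i.e. the Christoffel symbols of this chart at `x`), given by the Koszul
formula `2⟪∇_u ∂_v, w⟫ = ∂_u ⟪∂_v, ∂_w⟫ + ∂_v ⟪∂_u, ∂_w⟫ - ∂_w ⟪∂_u, ∂_v⟫`. -/
noncomputable def christoffel (x : M) (u v : TangentSpace I x) : TangentSpace I x :=
  let e := stdOrthonormalBasis ℝ (TangentSpace I x)
  ∑ i, ((metricDeriv I x u v (e i) + metricDeriv I x v u (e i) - metricDeriv I x (e i) u v) / 2) •
    e i

variable {E' : Type*} [NormedAddCommGroup E'] [NormedSpace ℝ E'] [FiniteDimensional ℝ E']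
  {H' : Type*} [TopologicalSpace H'] (J : ModelWithCorners ℝ E' H')
  {N : Type*} [TopologicalSpace N] [ChartedSpace H' N] [IsManifold J ∞ N]
  [RiemannianBundle (fun x : N => TangentSpace J x)]

/-- The energy density `e(f) = |df|² = ∑ᵢ |df(eᵢ)|²`. -/
noncomputable def energyDensity (f : M → N) (x : M) : ℝ :=
  let e := stdOrthonormalBasis ℝ (TangentSpace I x)
  ∑ i, ‖mfderiv I J f x (e i)‖ ^ 2

/-- The second derivative at `x` of the expression of `f` in the preferred charts at `x` and
`f x`. -/
noncomputable def coordHessian (f : M → N) (x : M) (u v : TangentSpace I x) :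
    TangentSpace J (f x) :=
  fderiv ℝ (fderiv ℝ (writtenInExtChartAt I J x f)) (extChartAt I x x) u v

/-- The second fundamental form `∇df` of a map `f` between Riemannian manifolds without boundary,
`(∇df)(u, v) = ∂_u∂_v f - df(∇_u ∂_v) + ∇_{df u} ∂_{df v}` in the preferred charts at `x` and
`f x`. -/
noncomputable def secondFundamentalForm (f : M → N) (x : M) (u v : TangentSpace I x) :
    TangentSpace J (f x) :=
  coordHessian I J f x u v - mfderiv I J f x (christoffel I x u v) +
    christoffel J (f x) (mfderiv I J f x u) (mfderiv I J f x v)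

/-- The tension field `τ(f) = trace ∇df`. -/
noncomputable def tensionField (f : M → N) (x : M) : TangentSpace J (f x) :=
  let e := stdOrthonormalBasis ℝ (TangentSpace I x)
  ∑ i, secondFundamentalForm I J f x (e i) (e i)

/-- A map is harmonic if its tension field vanishes identically. -/
def IsHarmonicMap (f : M → N) : Prop :=
  ∀ x, tensionField I J f x = 0

end Harmonic

/-! ### Grassmannians

`𝕜` is `ℝ` or `ℂ` and `W` is a finite-dimensional inner product space over `𝕜`. The real
Grassmannian is the Grassmannian of *oriented* `p`-planes; the complex one is the Grassmannian of
all `p`-planes. Both are the space of `p`-frames modulo the identity component of `GL_p(𝕜)`. -/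

/-- The determinants of the elements of the identity component of `GL_p(𝕜)` (for `p ≥ 1`): the
positive numbers if `𝕜 = ℝ` (the case in which the imaginary unit of `RCLike` vanishes) and all
nonzero numbers if `𝕜 = ℂ`. -/
def IsOrientationDet {𝕜 : Type*} [RCLike 𝕜] (d : 𝕜) : Prop :=
  d ≠ 0 ∧ ((RCLike.I : 𝕜) = 0 → 0 < RCLike.re d)

theorem isOrientationDet_real_iff (d : ℝ) : IsOrientationDet d ↔ 0 < d := by
  simp only [IsOrientationDet, RCLike.I_to_real, RCLike.re_to_real, forall_const]
  exact ⟨fun h => h.2, fun h => ⟨h.ne', h⟩⟩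

theorem isOrientationDet_complex_iff (d : ℂ) : IsOrientationDet d ↔ d ≠ 0 := by
  simp [IsOrientationDet]

theorem IsOrientationDet.one {𝕜 : Type*} [RCLike 𝕜] : IsOrientationDet (1 : 𝕜) := by
  simp [IsOrientationDet]

theorem IsOrientationDet.mul {𝕜 : Type*} [RCLike 𝕜] {a b : 𝕜} (ha : IsOrientationDet a)
    (hb : IsOrientationDet b) : IsOrientationDet (a * b) := by
  refine ⟨mul_ne_zero ha.1 hb.1, fun h => ?_⟩
  rw [RCLike.mul_re, RCLike.im_eq_zero h a, zero_mul, sub_zero]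
  exact mul_pos (ha.2 h) (hb.2 h)

theorem IsOrientationDet.of_mul_eq_one {𝕜 : Type*} [RCLike 𝕜] {a b : 𝕜} (ha : IsOrientationDet a)
    (hab : a * b = 1) : IsOrientationDet b := by
  refine ⟨right_ne_zero_of_mul_eq_one hab, fun h => ?_⟩
  have h1 : RCLike.re a * RCLike.re b = 1 := by
    have := congrArg RCLike.re hab
    rwa [RCLike.mul_re, RCLike.im_eq_zero h a, zero_mul, sub_zero, RCLike.one_re] at this
  exact (pos_iff_pos_of_mul_pos (h1 ▸ one_pos)).1 (ha.2 h)

theorem isOpen_isOrientationDet {𝕜 : Type*} [RCLike 𝕜] : IsOpen {d : 𝕜 | IsOrientationDet d} := by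
  by_cases h : (RCLike.I : 𝕜) = 0
  · have : {d : 𝕜 | IsOrientationDet d} = {d : 𝕜 | d ≠ 0} ∩ {d : 𝕜 | 0 < RCLike.re d} := by
      ext d; simp [IsOrientationDet, h]
    rw [this]
    exact isOpen_ne.inter (isOpen_lt continuous_const RCLike.continuous_re)
  · have : {d : 𝕜 | IsOrientationDet d} = {d : 𝕜 | d ≠ 0} := by
      ext d; simp [IsOrientationDet, h]
    rw [this]
    exact isOpen_ne

/-- A `p`-frame in `W`, i.e. `p` linearly independent vectors, as an injective linear map
`𝕜^p → W`. -/
def Frame (𝕜 W : Type*) [RCLike 𝕜] [NormedAddCommGroup W] [InnerProductSpace 𝕜 W] (p : ℕ) :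
    Type _ :=
  {Φ : EuclideanSpace 𝕜 (Fin p) →L[𝕜] W // Function.Injective Φ}

/-- Two frames are equivalent if they span the same plane and, when `𝕜 = ℝ`, induce the same
orientation on it. -/
def frameSetoid (𝕜 W : Type*) [RCLike 𝕜] [NormedAddCommGroup W] [InnerProductSpace 𝕜 W] (p : ℕ) :
    Setoid (Frame 𝕜 W p) where
  r Φ Φ' := ∃ B : EuclideanSpace 𝕜 (Fin p) →L[𝕜] EuclideanSpace 𝕜 (Fin p),
    IsOrientationDet B.det ∧ Φ'.1 = Φ.1 ∘L B
  iseqv :=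
    { refl := fun Φ => ⟨1, by
        have : (1 : EuclideanSpace 𝕜 (Fin p) →L[𝕜] EuclideanSpace 𝕜 (Fin p)).det = 1 := by
          simp [ContinuousLinearMap.det]
        rw [this]; exact IsOrientationDet.one, by ext; simp⟩
      symm := by
        rintro Φ Φ' ⟨B, hB, h⟩
        let e := B.toContinuousLinearEquivOfDetNeZero hB.1
        have he : B ∘L (e.symm : EuclideanSpace 𝕜 (Fin p) →L[𝕜] EuclideanSpace 𝕜 (Fin p)) = 1 := by
          ext1 v
          exact e.apply_symm_apply v
        refine ⟨e.symm, hB.of_mul_eq_one ?_, ?_⟩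
        · have := congrArg ContinuousLinearMap.det he
          simpa [ContinuousLinearMap.det] using this
        · rw [h, ContinuousLinearMap.comp_assoc, he]
          ext; simp
      trans := by
        rintro Φ Φ' Φ'' ⟨B, hB, h⟩ ⟨C, hC, h'⟩
        refine ⟨B ∘L C, ?_, by rw [h', h, ContinuousLinearMap.comp_assoc]⟩
        have : (B ∘L C).det = B.det * C.det := by
          simp [ContinuousLinearMap.det]
        rw [this]
        exact hB.mul hC }

/-- The Grassmannian `Gr_p(W)`: of oriented `p`-planes in `W` if `𝕜 = ℝ`, of `p`-planes in `W` if
`𝕜 = ℂ`. -/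
def Gr (𝕜 W : Type*) [RCLike 𝕜] [NormedAddCommGroup W] [InnerProductSpace 𝕜 W] (p : ℕ) : Type _ :=
  Quotient (frameSetoid 𝕜 W p)

/-- The vector space on which the Grassmannian is modelled, `Hom(𝕜^p, 𝕜^q)` with
`q = dim W - p`, regarded as a real vector space. -/
abbrev GrModel (𝕜 W : Type*) [RCLike 𝕜] [NormedAddCommGroup W] [InnerProductSpace 𝕜 W] (p : ℕ) :
    Type _ :=
  EuclideanSpace 𝕜 (Fin p) →L[𝕜] EuclideanSpace 𝕜 (Fin (Module.finrank 𝕜 W - p))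

namespace Gr

section Charts

variable {𝕜 W : Type*} [RCLike 𝕜] [NormedAddCommGroup W] [InnerProductSpace 𝕜 W] {p : ℕ}

/-- The oriented plane spanned by a frame. -/
def mk (Φ : Frame 𝕜 W p) : Gr 𝕜 W p := Quotient.mk (frameSetoid 𝕜 W p) Φ

/-- A frame of the plane `x`, compatible with its orientation. -/
noncomputable def frame (x : Gr 𝕜 W p) : EuclideanSpace 𝕜 (Fin p) →L[𝕜] W :=
  (Quotient.out x : Frame 𝕜 W p).1

theorem frame_injective (x : Gr 𝕜 W p) : Function.Injective x.frame :=
  (Quotient.out x : Frame 𝕜 W p).2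

theorem mk_frame (x : Gr 𝕜 W p) : mk ⟨x.frame, x.frame_injective⟩ = x := Quotient.out_eq x

theorem frame_mk (Φ : Frame 𝕜 W p) :
    ∃ B : EuclideanSpace 𝕜 (Fin p) →L[𝕜] EuclideanSpace 𝕜 (Fin p),
      IsOrientationDet B.det ∧ (mk Φ).frame = Φ.1 ∘L B :=
  (frameSetoid 𝕜 W p).iseqv.symm (Quotient.exact (Quotient.out_eq (mk Φ)))

theorem mk_eq_mk {Φ Φ' : Frame 𝕜 W p}
    (B : EuclideanSpace 𝕜 (Fin p) →L[𝕜] EuclideanSpace 𝕜 (Fin p))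
    (hB : IsOrientationDet B.det) (h : Φ'.1 = Φ.1 ∘L B) : mk Φ = mk Φ' :=
  Quotient.sound ⟨B, hB, h⟩

/-- The plane in `W` underlying a point of the Grassmannian: the fibre at `x` of the tautological
bundle `S → Gr_p(W)`. The fibre of the universal quotient bundle `Q → Gr_p(W)` at `x` is identified
with the orthogonal complement `(x.plane)ᗮ`. -/
noncomputable def plane (x : Gr 𝕜 W p) : Submodule 𝕜 W :=
  LinearMap.range (x.frame : EuclideanSpace 𝕜 (Fin p) →ₗ[𝕜] W)

theorem plane_mk (Φ : Frame 𝕜 W p) :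
    (mk Φ).plane = LinearMap.range (Φ.1 : EuclideanSpace 𝕜 (Fin p) →ₗ[𝕜] W) := by
  obtain ⟨B, hB, h⟩ := frame_mk Φ
  let e := B.toContinuousLinearEquivOfDetNeZero hB.1
  ext w
  simp only [plane, h, LinearMap.mem_range, ContinuousLinearMap.coe_coe,
    ContinuousLinearMap.comp_apply]
  exact ⟨fun ⟨v, hv⟩ => ⟨B v, hv⟩, fun ⟨v, hv⟩ => ⟨e.symm v, by
    rw [← hv]; exact congrArg Φ.1 (e.apply_symm_apply v)⟩⟩

theorem finrank_plane (x : Gr 𝕜 W p) : Module.finrank 𝕜 x.plane = p := by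
  rw [plane, LinearMap.finrank_range_of_inj x.frame_injective]
  simp

variable [FiniteDimensional 𝕜 W]

/-- The chosen frame as an isomorphism `𝕜^p ≃ S_x`. -/
noncomputable def frameEquiv (x : Gr 𝕜 W p) : EuclideanSpace 𝕜 (Fin p) ≃L[𝕜] x.plane :=
  (LinearEquiv.ofInjective (x.frame : EuclideanSpace 𝕜 (Fin p) →ₗ[𝕜] W)
    x.frame_injective).toContinuousLinearEquiv

theorem finrank_planeOrthogonal (x : Gr 𝕜 W p) :
    Module.finrank 𝕜 (x.plane)ᗮ = Module.finrank 𝕜 W - p := by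
  have := x.plane.finrank_add_finrank_orthogonal
  rw [x.finrank_plane] at this
  omega

/-- An orthonormal frame of the orthogonal complement, as an isometry `Q_x ≃ 𝕜^q`. -/
noncomputable def coframeEquiv (x : Gr 𝕜 W p) :
    (x.plane)ᗮ ≃ₗᵢ[𝕜] EuclideanSpace 𝕜 (Fin (Module.finrank 𝕜 W - p)) :=
  ((stdOrthonormalBasis 𝕜 (x.plane)ᗮ).reindex (finCongr x.finrank_planeOrthogonal)).repr

/-- The coordinates, in the chosen frame, of the orthogonal projection of a vector to `S_x`. -/
noncomputable def coordS (x : Gr 𝕜 W p) : W →L[𝕜] EuclideanSpace 𝕜 (Fin p) :=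
  (x.frameEquiv.symm : x.plane →L[𝕜] EuclideanSpace 𝕜 (Fin p)) ∘L x.plane.orthogonalProjectionOnto

/-- The coordinates, in the chosen frame, of the orthogonal projection of a vector to `Q_x`. -/
noncomputable def coordQ (x : Gr 𝕜 W p) :
    W →L[𝕜] EuclideanSpace 𝕜 (Fin (Module.finrank 𝕜 W - p)) :=
  (x.coframeEquiv.toContinuousLinearEquiv :
    (x.plane)ᗮ →L[𝕜] EuclideanSpace 𝕜 (Fin (Module.finrank 𝕜 W - p))) ∘L
      (x.plane)ᗮ.orthogonalProjectionOnto

/-- The chosen orthonormal frame of `Q_x` as a map into `W`. -/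
noncomputable def coframe (x : Gr 𝕜 W p) :
    EuclideanSpace 𝕜 (Fin (Module.finrank 𝕜 W - p)) →L[𝕜] W :=
  (x.plane)ᗮ.subtypeL ∘L (x.coframeEquiv.symm.toContinuousLinearEquiv :
    EuclideanSpace 𝕜 (Fin (Module.finrank 𝕜 W - p)) →L[𝕜] (x.plane)ᗮ)

theorem frame_comp_coordS_add (x : Gr 𝕜 W p) (w : W) :
    x.frame (x.coordS w) + x.coframe (x.coordQ w) = w := by
  rw [show x.frame = x.plane.subtypeL ∘L (x.frameEquiv : EuclideanSpace 𝕜 (Fin p) →L[𝕜] x.plane) from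
    rfl]
  simp [coordS, coframe, coordQ]

theorem coordS_frame (x : Gr 𝕜 W p) (c : EuclideanSpace 𝕜 (Fin p)) :
    x.coordS (x.frame c) = c := by
  rw [show x.frame = x.plane.subtypeL ∘L (x.frameEquiv : EuclideanSpace 𝕜 (Fin p) →L[𝕜] x.plane) from
    rfl]
  simp [coordS]

theorem coordS_coframe (x : Gr 𝕜 W p)
    (c : EuclideanSpace 𝕜 (Fin (Module.finrank 𝕜 W - p))) :
    x.coordS (x.coframe c) = 0 := by
  have := Submodule.orthogonalProjectionOnto_apply_of_mem_orthogonal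
    (K := x.plane) (x.coframeEquiv.symm c).2
  simp [coordS, coframe, this]

theorem coordQ_frame (x : Gr 𝕜 W p) (c : EuclideanSpace 𝕜 (Fin p)) :
    x.coordQ (x.frame c) = 0 := by
  have h : x.frame c ∈ (x.plane)ᗮᗮ :=
    Submodule.le_orthogonal_orthogonal _ (x.frameEquiv c).2
  have := Submodule.orthogonalProjectionOnto_apply_of_mem_orthogonal (K := (x.plane)ᗮ) h
  simp [coordQ, this]

theorem coordQ_coframe (x : Gr 𝕜 W p)
    (c : EuclideanSpace 𝕜 (Fin (Module.finrank 𝕜 W - p))) :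
    x.coordQ (x.coframe c) = c := by
  simp [coordQ, coframe]

/-- The frame of the graph of the linear map `S_x → Q_x` with matrix `A`. -/
noncomputable def graphFrame (x : Gr 𝕜 W p) (A : GrModel 𝕜 W p) : Frame 𝕜 W p :=
  ⟨x.frame + x.coframe ∘L A, by
    refine Function.LeftInverse.injective (g := x.coordS) fun c => ?_
    simp [coordS_frame, coordS_coframe]⟩

/-- The graph chart centred at `x`: the planes `y` that project isomorphically (and, if `𝕜 = ℝ`,
preserving the orientations) to `S_x` are the graphs of the linear maps `S_x → Q_x`, and these maps
are written as matrices in the chosen frames. -/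
noncomputable def graphChart (x : Gr 𝕜 W p) : PartialEquiv (Gr 𝕜 W p) (GrModel 𝕜 W p) where
  toFun y := x.coordQ ∘L y.frame ∘L Ring.inverse (x.coordS ∘L y.frame)
  invFun A := mk (x.graphFrame A)
  source := {y | IsOrientationDet (x.coordS ∘L y.frame).det}
  target := Set.univ
  map_source' _ _ := Set.mem_univ _
  map_target' A _ := by
    obtain ⟨B, hB, h⟩ := frame_mk (x.graphFrame A)
    have : x.coordS ∘L (mk (x.graphFrame A)).frame = B := by
      ext1 c
      rw [ContinuousLinearMap.comp_apply, h]
      simp [graphFrame, coordS_frame, coordS_coframe]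
    simpa only [Set.mem_ofPred_eq, this] using hB
  left_inv' y hy := by
    set B := x.coordS ∘L y.frame with hBdef
    let e := B.toContinuousLinearEquivOfDetNeZero hy.1
    have hu : IsUnit B := ⟨ContinuousLinearEquiv.toUnit e, rfl⟩
    have hBi : Ring.inverse B * B = 1 := Ring.inverse_mul_cancel B hu
    refine (mk_eq_mk B hy ?_).trans y.mk_frame
    ext1 c
    have hc : Ring.inverse B (B c) = c := congrArg (fun T => T c) hBi
    simp only [graphFrame, ContinuousLinearMap.comp_apply, add_apply, hc]
    exact (x.frame_comp_coordS_add (y.frame c)).symm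
  right_inv' A _ := by
    obtain ⟨B, hB, h⟩ := frame_mk (x.graphFrame A)
    have h1 : x.coordS ∘L (mk (x.graphFrame A)).frame = B := by
      ext1 c
      rw [ContinuousLinearMap.comp_apply, h]
      simp [graphFrame, coordS_frame, coordS_coframe]
    let e := B.toContinuousLinearEquivOfDetNeZero hB.1
    have hu : IsUnit B := ⟨ContinuousLinearEquiv.toUnit e, rfl⟩
    have hBi : B * Ring.inverse B = 1 := Ring.mul_inverse_cancel B hu
    rw [h1]
    ext1 c
    have hc : B (Ring.inverse B c) = c := congrArg (fun T => T c) hBi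
    rw [ContinuousLinearMap.comp_apply, ContinuousLinearMap.comp_apply, h,
      ContinuousLinearMap.comp_apply, hc]
    simp [graphFrame, coordQ_frame, coordQ_coframe]

theorem graphChart_symm_trans_apply (x y : Gr 𝕜 W p) (A : GrModel 𝕜 W p) :
    (x.graphChart.symm.trans y.graphChart) A =
      y.coordQ ∘L (x.frame + x.coframe ∘L A) ∘L
        Ring.inverse (y.coordS ∘L (x.frame + x.coframe ∘L A)) := by
  obtain ⟨B, hB, h⟩ := frame_mk (x.graphFrame A)
  let e := B.toContinuousLinearEquivOfDetNeZero hB.1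
  have hu : IsUnit B := ⟨ContinuousLinearEquiv.toUnit e, rfl⟩
  have hinv (C : EuclideanSpace 𝕜 (Fin p) →L[𝕜] EuclideanSpace 𝕜 (Fin p)) :
      B * Ring.inverse (C * B) = Ring.inverse C := by
    obtain ⟨u, rfl⟩ := hu
    by_cases hC : IsUnit C
    · obtain ⟨v, rfl⟩ := hC
      rw [← Units.val_mul, Ring.inverse_unit, Ring.inverse_unit, mul_inv_rev, Units.val_mul,
        Units.mul_inv_cancel_left]
    · rw [Ring.inverse_non_unit _ hC, Ring.inverse_non_unit _ (by simpa using hC), mul_zero]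
  change y.coordQ ∘L (mk (x.graphFrame A)).frame ∘L
    Ring.inverse (y.coordS ∘L (mk (x.graphFrame A)).frame) = _
  rw [h, ← hinv (y.coordS ∘L (x.frame + x.coframe ∘L A))]
  rfl

theorem graphChart_symm_trans_source (x y : Gr 𝕜 W p) :
    (x.graphChart.symm.trans y.graphChart).source =
      {A | IsOrientationDet (y.coordS ∘L (x.frame + x.coframe ∘L A)).det} := by
  ext A
  obtain ⟨B, hB, h⟩ := frame_mk (x.graphFrame A)
  have hdet : (y.coordS ∘L (mk (x.graphFrame A)).frame).det =
      (y.coordS ∘L (x.frame + x.coframe ∘L A)).det * B.det := by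
    rw [h]
    simp [ContinuousLinearMap.det, graphFrame, ← LinearMap.det_comp]
    rfl
  have hB' : IsOrientationDet (B.det)⁻¹ := hB.of_mul_eq_one (mul_inv_cancel₀ hB.1)
  have : A ∈ (x.graphChart.symm.trans y.graphChart).source ↔
      IsOrientationDet (y.coordS ∘L (mk (x.graphFrame A)).frame).det := by
    simp [PartialEquiv.trans_source, graphChart]
  rw [this, hdet, Set.mem_ofPred_eq]
  refine ⟨fun h => ?_, fun h => h.mul hB⟩
  have := h.mul hB'
  rwa [mul_inv_cancel_right₀ hB.1] at this

theorem isOpen_graphChart_symm_trans_source (x y : Gr 𝕜 W p) :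
    IsOpen (x.graphChart.symm.trans y.graphChart).source := by
  rw [graphChart_symm_trans_source]
  have h : Continuous fun A : GrModel 𝕜 W p =>
      (y.coordS ∘L (x.frame + x.coframe ∘L A)).det :=
    ContinuousLinearMap.continuous_det.comp (by fun_prop)
  exact isOpen_isOrientationDet.preimage h

theorem contDiffOn_graphChart_symm_trans (x y : Gr 𝕜 W p) :
    ContDiffOn 𝕜 ∞ (x.graphChart.symm.trans y.graphChart)
      (x.graphChart.symm.trans y.graphChart).source := by
  intro A hA
  rw [graphChart_symm_trans_source] at hA
  refine ContDiffAt.contDiffWithinAt ?_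
  rw [show (x.graphChart.symm.trans y.graphChart : GrModel 𝕜 W p → GrModel 𝕜 W p) = _ from
    funext (graphChart_symm_trans_apply x y)]
  let e := (y.coordS ∘L (x.frame + x.coframe ∘L A)).toContinuousLinearEquivOfDetNeZero hA.1
  have h1 : ContDiffAt 𝕜 ∞ (fun A : GrModel 𝕜 W p => x.frame + x.coframe ∘L A) A := by fun_prop
  have h2 : ContDiffAt 𝕜 ∞
      (fun A : GrModel 𝕜 W p => y.coordS ∘L (x.frame + x.coframe ∘L A)) A := by fun_prop
  have h3 : ContDiffAt 𝕜 ∞ (fun A : GrModel 𝕜 W p =>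
      Ring.inverse (y.coordS ∘L (x.frame + x.coframe ∘L A))) A :=
    ContDiffAt.comp (g := Ring.inverse) A
      (contDiffAt_ringInverse 𝕜 (ContinuousLinearEquiv.toUnit e)) h2
  exact contDiffAt_const.clm_comp (h1.clm_comp h3)

/-- The atlas of the graph charts. -/
noncomputable def chartedSpaceCore (𝕜 W : Type*) [RCLike 𝕜] [NormedAddCommGroup W]
    [InnerProductSpace 𝕜 W] [FiniteDimensional 𝕜 W] (p : ℕ) :
    ChartedSpaceCore (GrModel 𝕜 W p) (Gr 𝕜 W p) where
  atlas := Set.range graphChart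
  chartAt := graphChart
  mem_chart_source x := by
    have : x.coordS ∘L x.frame = 1 := by ext1 c; exact x.coordS_frame c
    change IsOrientationDet (x.coordS ∘L x.frame).det
    rw [this]
    simpa [ContinuousLinearMap.det] using IsOrientationDet.one
  chart_mem_atlas x := ⟨x, rfl⟩
  open_source := by
    rintro _ _ ⟨x, rfl⟩ ⟨y, rfl⟩
    exact isOpen_graphChart_symm_trans_source x y
  continuousOn_toFun := by
    rintro _ _ ⟨x, rfl⟩ ⟨y, rfl⟩
    exact (contDiffOn_graphChart_symm_trans x y).continuousOn

noncomputable instance : TopologicalSpace (Gr 𝕜 W p) :=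
  (chartedSpaceCore 𝕜 W p).toTopologicalSpace

noncomputable instance : ChartedSpace (GrModel 𝕜 W p) (Gr 𝕜 W p) :=
  (chartedSpaceCore 𝕜 W p).toChartedSpace

instance : IsManifold 𝓘(ℝ, GrModel 𝕜 W p) ∞ (Gr 𝕜 W p) := by
  refine isManifold_of_contDiffOn _ _ _ fun e e' he he' => ?_
  change e ∈ ⋃ (e : PartialEquiv (Gr 𝕜 W p) (GrModel 𝕜 W p))
    (he : e ∈ (chartedSpaceCore 𝕜 W p).atlas),
      {(chartedSpaceCore 𝕜 W p).openPartialHomeomorph e he} at he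
  change e' ∈ ⋃ (e : PartialEquiv (Gr 𝕜 W p) (GrModel 𝕜 W p))
    (he : e ∈ (chartedSpaceCore 𝕜 W p).atlas),
      {(chartedSpaceCore 𝕜 W p).openPartialHomeomorph e he} at he'
  simp only [Set.mem_iUnion, Set.mem_singleton_iff] at he he'
  obtain ⟨_, ⟨x, rfl⟩, rfl⟩ := he
  obtain ⟨_, ⟨y, rfl⟩, rfl⟩ := he'
  have := ((contDiffOn_graphChart_symm_trans x y).restrict_scalars ℝ)
  refine ContDiffOn.congr_mono this (fun _ _ => rfl) ?_
  intro A hA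
  exact hA.1

end Charts

section Metric

variable {𝕜 W : Type*} [RCLike 𝕜] [NormedAddCommGroup W] [InnerProductSpace 𝕜 W]
  [FiniteDimensional 𝕜 W] {p : ℕ}

instance : FiniteDimensional ℝ (GrModel 𝕜 W p) :=
  FiniteDimensional.trans ℝ 𝕜 (GrModel 𝕜 W p)

/-- The identification `T_x Gr_p(W) = Hom(S_x, Q_x)`: a tangent vector at `x`, which is a matrix in
the graph chart centred at `x`, is sent to the linear map `S_x → Q_x` with this matrix. -/
noncomputable def tangentToHom (x : Gr 𝕜 W p) (X : GrModel 𝕜 W p) :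
    x.plane →L[𝕜] (x.plane)ᗮ :=
  (x.coframeEquiv.symm.toContinuousLinearEquiv :
    EuclideanSpace 𝕜 (Fin (Module.finrank 𝕜 W - p)) →L[𝕜] (x.plane)ᗮ) ∘L
      X ∘L
        (x.frameEquiv.symm : x.plane →L[𝕜] EuclideanSpace 𝕜 (Fin p))

/-- The metric of Fubini-Study type `g_S ⊗ g_Q` on `T_x Gr_p(W) = Hom(S_x, Q_x)` (its real part if
`𝕜 = ℂ`): `g(X, Y) = Re ∑ⱼ ⟪X sⱼ, Y sⱼ⟫` for an orthonormal basis `sⱼ` of `S_x`. -/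
noncomputable def fubiniStudyInner (x : Gr 𝕜 W p) (X Y : GrModel 𝕜 W p) : ℝ :=
  let s := stdOrthonormalBasis 𝕜 x.plane
  ∑ j, RCLike.re (inner 𝕜 (x.tangentToHom X (s j)) (x.tangentToHom Y (s j)))

theorem tangentToHom_add (x : Gr 𝕜 W p) (X Y : GrModel 𝕜 W p)
    (s : x.plane) :
    x.tangentToHom (X + Y) s = x.tangentToHom X s + x.tangentToHom Y s :=
  map_add x.coframeEquiv.symm _ _

theorem tangentToHom_smul (x : Gr 𝕜 W p) (r : ℝ) (X : GrModel 𝕜 W p)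
    (s : x.plane) :
    x.tangentToHom (r • X) s = (r : 𝕜) • x.tangentToHom X s := by
  refine Eq.trans ?_ (x.coframeEquiv.symm.map_smul ((r : 𝕜)) _)
  rw [← RCLike.real_smul_eq_coe_smul]
  rfl

theorem fubiniStudyInner_self (x : Gr 𝕜 W p) (X : GrModel 𝕜 W p) :
    x.fubiniStudyInner X X = ∑ j, ‖x.tangentToHom X (stdOrthonormalBasis 𝕜 x.plane j)‖ ^ 2 :=
  Finset.sum_congr rfl fun _ _ => inner_self_eq_norm_sq _

theorem fubiniStudyInner_symm (x : Gr 𝕜 W p) (X Y : GrModel 𝕜 W p) :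
    x.fubiniStudyInner X Y = x.fubiniStudyInner Y X :=
  Finset.sum_congr rfl fun _ _ => inner_re_symm _ _

theorem exists_norm_sq_le_fubiniStudyInner (x : Gr 𝕜 W p) :
    ∃ C : ℝ, ∀ X : GrModel 𝕜 W p, ‖X‖ ^ 2 ≤ C ^ 2 * x.fubiniStudyInner X X := by
  let s := stdOrthonormalBasis 𝕜 x.plane
  let Φ : EuclideanSpace 𝕜 (Fin p) →L[𝕜] x.plane := x.frameEquiv
  refine ⟨Fintype.card (Fin (Module.finrank 𝕜 x.plane)) * ‖Φ‖, fun X => ?_⟩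
  have hg : 0 ≤ x.fubiniStudyInner X X := by
    rw [fubiniStudyInner_self]; positivity
  have hs (j) : ‖x.tangentToHom X (s j)‖ ≤ √(x.fubiniStudyInner X X) := by
    refine Real.le_sqrt_of_sq_le ?_
    rw [fubiniStudyInner_self]
    exact Finset.single_le_sum (f := fun j => ‖x.tangentToHom X (s j)‖ ^ 2)
      (fun _ _ => by positivity) (Finset.mem_univ j)
  have hX : ‖X‖ ≤
      Fintype.card (Fin (Module.finrank 𝕜 x.plane)) * ‖Φ‖ * √(x.fubiniStudyInner X X) := by
    refine X.opNorm_le_bound (by positivity) fun c => ?_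
    have h1 : ‖X c‖ = ‖x.tangentToHom X (Φ c)‖ := by
      have : x.tangentToHom X (Φ c) = x.coframeEquiv.symm (X c) := by
        change x.coframeEquiv.symm (X (x.frameEquiv.symm (x.frameEquiv c))) = _
        rw [ContinuousLinearEquiv.symm_apply_apply]
      rw [this, LinearIsometryEquiv.norm_map]
    have h2 : x.tangentToHom X (Φ c) = ∑ j, inner 𝕜 (s j) (Φ c) • x.tangentToHom X (s j) := by
      conv_lhs => rw [← s.sum_repr' (Φ c)]
      simp
    rw [h1, h2]
    have h3 (j) (_ : j ∈ Finset.univ) : ‖inner 𝕜 (s j) (Φ c) • x.tangentToHom X (s j)‖ ≤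
        ‖Φ‖ * ‖c‖ * √(x.fubiniStudyInner X X) := by
      rw [norm_smul]
      refine mul_le_mul ?_ (hs j) (norm_nonneg _) (by positivity)
      refine (norm_inner_le_norm _ _).trans ?_
      rw [s.norm_eq_one, one_mul]
      exact Φ.le_opNorm c
    refine (norm_sum_le_of_le _ h3).trans (le_of_eq ?_)
    rw [Finset.sum_const, nsmul_eq_mul, Finset.card_univ]
    ring
  calc ‖X‖ ^ 2 ≤ (Fintype.card (Fin (Module.finrank 𝕜 x.plane)) * ‖Φ‖ *
        √(x.fubiniStudyInner X X)) ^ 2 := by gcongr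
    _ = _ := by rw [mul_pow, Real.sq_sqrt hg]

/-- The metric of Fubini-Study type as a continuous bilinear form. -/
noncomputable def fubiniStudyForm (x : Gr 𝕜 W p) :
    GrModel 𝕜 W p →L[ℝ] GrModel 𝕜 W p →L[ℝ] ℝ :=
  (LinearMap.mk₂ ℝ (fun X Y : GrModel 𝕜 W p => x.fubiniStudyInner X Y)
    (fun X X' Y => by
      rw [fubiniStudyInner, fubiniStudyInner, fubiniStudyInner, ← Finset.sum_add_distrib]
      refine Finset.sum_congr rfl fun j _ => ?_
      rw [← map_add, ← inner_add_left]
      exact congrArg (fun v => RCLike.re (inner 𝕜 v _)) (x.tangentToHom_add X X' _))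
    (fun r X Y => by
      rw [fubiniStudyInner, fubiniStudyInner, smul_eq_mul, Finset.mul_sum]
      refine Finset.sum_congr rfl fun j _ => ?_
      rw [← RCLike.re_ofReal_mul, ← RCLike.conj_ofReal r, ← inner_smul_left]
      exact congrArg (fun v => RCLike.re (inner 𝕜 v _)) (x.tangentToHom_smul r X _))
    (fun X Y Y' => by
      rw [fubiniStudyInner, fubiniStudyInner, fubiniStudyInner, ← Finset.sum_add_distrib]
      refine Finset.sum_congr rfl fun j _ => ?_
      rw [← map_add, ← inner_add_right]
      exact congrArg (fun v => RCLike.re (inner 𝕜 _ v)) (x.tangentToHom_add Y Y' _))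
    (fun r X Y => by
      rw [fubiniStudyInner, fubiniStudyInner, smul_eq_mul, Finset.mul_sum]
      refine Finset.sum_congr rfl fun j _ => ?_
      rw [← RCLike.re_ofReal_mul, ← inner_smul_right]
      exact congrArg (fun v => RCLike.re (inner 𝕜 _ v))
        (x.tangentToHom_smul r Y _))).toContinuousBilinearMap

theorem fubiniStudyForm_apply (x : Gr 𝕜 W p) (X Y : GrModel 𝕜 W p) :
    x.fubiniStudyForm X Y = x.fubiniStudyInner X Y := by
  rw [fubiniStudyForm, LinearMap.toContinuousBilinearMap_apply, LinearMap.mk₂_apply]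

theorem fubiniStudyForm_symm (x : Gr 𝕜 W p) (X Y : GrModel 𝕜 W p) :
    x.fubiniStudyForm X Y = x.fubiniStudyForm Y X := by
  rw [fubiniStudyForm_apply, fubiniStudyForm_apply, fubiniStudyInner_symm]

theorem fubiniStudyForm_pos (x : Gr 𝕜 W p) (X : GrModel 𝕜 W p) (hX : X ≠ 0) :
    0 < x.fubiniStudyForm X X := by
  obtain ⟨C, hC⟩ := x.exists_norm_sq_le_fubiniStudyInner
  rw [fubiniStudyForm_apply]
  have h : 0 < C ^ 2 * x.fubiniStudyInner X X :=
    (pow_pos (norm_pos_iff.2 hX) 2).trans_le (hC X)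
  exact pos_of_mul_pos_right h (sq_nonneg C)

theorem isVonNBounded_fubiniStudyForm (x : Gr 𝕜 W p) :
    Bornology.IsVonNBounded ℝ {X : GrModel 𝕜 W p | x.fubiniStudyForm X X < 1} := by
  obtain ⟨C, hC⟩ := x.exists_norm_sq_le_fubiniStudyInner
  refine (NormedSpace.isVonNBounded_closedBall ℝ (GrModel 𝕜 W p) |C|).subset fun X hX => ?_
  have hX' : x.fubiniStudyInner X X < 1 := by
    rw [← fubiniStudyForm_apply]; exact hX
  rw [mem_closedBall_zero_iff]
  refine (abs_le_of_sq_le_sq' ?_ (abs_nonneg C)).2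
  rw [sq_abs]
  exact (hC X).trans (mul_le_of_le_one_right (sq_nonneg C) hX'.le)

theorem continuous_fubiniStudyForm (x : Gr 𝕜 W p) :
    Continuous fun X : GrModel 𝕜 W p => x.fubiniStudyForm X X := by
  fun_prop

/-- The Riemannian metric of Fubini-Study type on `Gr_p(W)`. -/
noncomputable def fubiniStudyMetric (𝕜 W : Type*) [RCLike 𝕜] [NormedAddCommGroup W]
    [InnerProductSpace 𝕜 W] [FiniteDimensional 𝕜 W] (p : ℕ) :
    RiemannianMetric (fun x : Gr 𝕜 W p => TangentSpace 𝓘(ℝ, GrModel 𝕜 W p) x) where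
  inner x := x.fubiniStudyForm
  symm x := x.fubiniStudyForm_symm
  pos x := x.fubiniStudyForm_pos
  continuousAt x := x.continuous_fubiniStudyForm.continuousAt
  isVonNBounded x := x.isVonNBounded_fubiniStudyForm

noncomputable instance : RiemannianBundle
    (fun x : Gr 𝕜 W p => TangentSpace 𝓘(ℝ, GrModel 𝕜 W p) x) :=
  ⟨fubiniStudyMetric 𝕜 W p⟩

end Metric

section Bundles

variable {𝕜 W : Type*} [RCLike 𝕜] [NormedAddCommGroup W] [InnerProductSpace 𝕜 W]
  [NormedSpace ℝ W] [IsScalarTower ℝ 𝕜 W] [FiniteDimensional 𝕜 W] {p : ℕ}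

/-- The second fundamental form `H` of the subbundle `S` of the trivial bundle `W`:
`H_X s = π_Q (∂_X s̃)` for a local section `s̃` of `S` with `s̃(x) = s`. The section
`s̃(y) = π_{S_y} s` is used. -/
noncomputable def secondFormH (x : Gr 𝕜 W p) (X : TangentSpace 𝓘(ℝ, GrModel 𝕜 W p) x) :
    x.plane →L[𝕜] (x.plane)ᗮ :=
  let dπ : W →L[𝕜] W := mfderiv 𝓘(ℝ, GrModel 𝕜 W p) 𝓘(ℝ, W →L[𝕜] W)
    (fun y : Gr 𝕜 W p => y.plane.starProjection) x X
  (x.plane)ᗮ.orthogonalProjectionOnto ∘L dπ ∘L x.plane.subtypeL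

/-- The second fundamental form `K` of the subbundle `Q` of the trivial bundle `W`:
`K_X t = π_S (∂_X t̃)` for a local section `t̃` of `Q` with `t̃(x) = t`. The section
`t̃(y) = π_{Q_y} t` is used. -/
noncomputable def secondFormK (x : Gr 𝕜 W p) (X : TangentSpace 𝓘(ℝ, GrModel 𝕜 W p) x) :
    (x.plane)ᗮ →L[𝕜] x.plane :=
  let dπ : W →L[𝕜] W := mfderiv 𝓘(ℝ, GrModel 𝕜 W p) 𝓘(ℝ, W →L[𝕜] W)
    (fun y : Gr 𝕜 W p => (y.plane)ᗮ.starProjection) x X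
  x.plane.orthogonalProjectionOnto ∘L dπ ∘L (x.plane)ᗮ.subtypeL

end Bundles

end Gr

/-! ### The pull-back `f^*Q` of the universal quotient bundle -/

section Pullback

variable {𝕜 W : Type*} [RCLike 𝕜] [NormedAddCommGroup W] [InnerProductSpace 𝕜 W]
  [NormedSpace ℝ W] [IsScalarTower ℝ 𝕜 W] [FiniteDimensional 𝕜 W] {p : ℕ}
  {E : Type*} [NormedAddCommGroup E] [NormedSpace ℝ E] [FiniteDimensional ℝ E]
  {H : Type*} [TopologicalSpace H] (I : ModelWithCorners ℝ E H)
  {M : Type*} [TopologicalSpace M] [ChartedSpace H M] [IsManifold I ∞ M]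
  [RiemannianBundle (fun x : M => TangentSpace I x)]

/-- The sections of `f^*Q → M`. -/
abbrev PullbackSection (f : M → Gr 𝕜 W p) : Type _ :=
  ∀ x : M, ((f x).plane)ᗮ

/-- The section of `f^*Q` corresponding to the vector `w ∈ W`. -/
noncomputable def sectionOf (f : M → Gr 𝕜 W p) (w : W) : PullbackSection f :=
  fun x => ((f x).plane)ᗮ.orthogonalProjectionOnto w

/-- `W` regarded as a space of sections of `f^*Q`. -/
def spaceOfSections (f : M → Gr 𝕜 W p) : Set (PullbackSection f) :=
  Set.range (sectionOf f)

/-- The connection of `f^*Q`, pulled back from the canonical connection `∇^Q t = π_Q d(i_Q t)`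
of `Q`: the orthogonal projection to `f^*Q` of the derivative of a section in the trivial bundle
`M × W`. -/
noncomputable def connection (f : M → Gr 𝕜 W p) (t : PullbackSection f) (x : M)
    (u : TangentSpace I x) : ((f x).plane)ᗮ :=
  let dt : W := mfderiv I 𝓘(ℝ, W) (fun y => (t y : W)) x u
  ((f x).plane)ᗮ.orthogonalProjectionOnto dt

/-- The second covariant derivative `(∇_u (∇t))(v) = ∇_u (∇_{∂_v} t) - ∇_{∇_u ∂_v} t`. -/
noncomputable def connectionHessian (f : M → Gr 𝕜 W p) (t : PullbackSection f) (x : M)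
    (u v : TangentSpace I x) : ((f x).plane)ᗮ :=
  connection I f (fun y => connection I f t y (coordField I x v y)) x u -
    connection I f t x (christoffel I x u v)

/-- The Laplace operator `Δ = ∇^*∇ = -∑ᵢ (∇_{eᵢ} ∇)(eᵢ)` on the sections of `f^*Q`. -/
noncomputable def laplacian (f : M → Gr 𝕜 W p) (t : PullbackSection f) : PullbackSection f :=
  fun x => -∑ i, connectionHessian I f t x (stdOrthonormalBasis ℝ (TangentSpace I x) i)
    (stdOrthonormalBasis ℝ (TangentSpace I x) i)

/-- The mean curvature operator `A = ∑ᵢ H_{df(eᵢ)} K_{df(eᵢ)}` of `f`. -/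
noncomputable def meanCurvatureOperator (f : M → Gr 𝕜 W p) (x : M) :
    ((f x).plane)ᗮ →L[𝕜] ((f x).plane)ᗮ :=
  let e := stdOrthonormalBasis ℝ (TangentSpace I x)
  ∑ i, (f x).secondFormH (mfderiv I 𝓘(ℝ, GrModel 𝕜 W p) f x (e i)) ∘L
    (f x).secondFormK (mfderiv I 𝓘(ℝ, GrModel 𝕜 W p) f x (e i))

/-- The zero set of a section. -/
def zeroSet (f : M → Gr 𝕜 W p) (t : PullbackSection f) : Set M :=
  {x | t x = 0}

/-- A space of sections has the zero property for the Laplacian if `Z_t ⊆ Z_{Δt}` for each of its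
elements `t`. -/
def HasZeroProperty (f : M → Gr 𝕜 W p) (T : Set (PullbackSection f)) : Prop :=
  ∀ t ∈ T, zeroSet f t ⊆ zeroSet f (laplacian I f t)

end Pullback

/-! Let `P` be the orthogonal projection of `W` onto the plane `f x`, so that the section defined by
`w` is `(1 - P) w`. Everything follows from one pointwise formula, `coe_laplacian_sectionOf`: `Δ t_w
= τ(f) w - A t_w`. Here `τ(f)(x)`, a linear map from `S` to `Q`, is extended by zero on `Q`
(`homExt`).

If `τ(f) = 0`, then `Δ t = -A t`, and since `A` acts fibrewise the zero property holds. Conversely,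
a vector `w` of the plane `f x` defines a section that vanishes at `x`; the zero property leaves
`τ(f) w = 0` for all such `w`, hence `τ(f)(x) = 0`.

Two facts give the formula. In the graph chart centred at `f x` the Christoffel symbols vanish at
the centre (`christoffel_eq_zero`), because the reflection of `W` in that plane acts as `A ↦ -A` on
the chart and makes the metric coefficients even. Moreover, differentiating twice both `P² = P` and
the statement that `P` fixes the vectors of the graph expresses the `Q`-part of `P''` through the
second derivative of the chart expression and the square of `P'` (`second_deriv_graphProj`). The
first contributes `τ(f)` and the second `A`.

The energy identity is separate pointwise algebra: `H_X` is `X` itself and `K_X = -X^*`, so the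
trace of `H_X K_X` is `-|X|²`. -/

section Charts

/-! ### Derivatives in the preferred charts of a manifold. -/

variable {E : Type*} [NormedAddCommGroup E] [NormedSpace ℝ E]
  {H : Type*} [TopologicalSpace H] {I : ModelWithCorners ℝ E H} [I.Boundaryless]
  {M : Type*} [TopologicalSpace M] [ChartedSpace H M]
  {V : Type*} [NormedAddCommGroup V] [NormedSpace ℝ V]

theorem mfderiv_eq_fderiv_comp_extChartAt_symm {g : M → V} {x : M}
    (hg : MDifferentiableAt I 𝓘(ℝ, V) g x) (u : TangentSpace I x) :
    mfderiv I 𝓘(ℝ, V) g x u = fderiv ℝ (g ∘ (extChartAt I x).symm) (extChartAt I x x) u := by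
  have h : mfderiv I 𝓘(ℝ, V) g x =
      fderivWithin ℝ (g ∘ (extChartAt I x).symm) (Set.range I) (extChartAt I x x) := if_pos hg
  rw [h, I.range_eq_univ, fderivWithin_univ]
  rfl

/-- The field `∂_v` is the push-forward of the constant vector `v` under the inverse chart, so the
chain rule turns a derivative along it into a directional derivative, at every point of the chart
domain and not only at its centre. -/
theorem mfderiv_coordField [IsManifold I ∞ M] {g : M → V} {x y : M}
    (hy : y ∈ (chartAt H x).source)
    (hg : MDifferentiableAt I 𝓘(ℝ, V) g y) (v : TangentSpace I x) :
    mfderiv I 𝓘(ℝ, V) g y (coordField I x v y) =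
      fderiv ℝ (g ∘ (extChartAt I x).symm) (extChartAt I x y) v := by
  have hy' : y ∈ (extChartAt I x).source := by simpa using hy
  have hs : MDifferentiableAt 𝓘(ℝ, E) I (extChartAt I x).symm (extChartAt I x y) := by
    have := mdifferentiableWithinAt_extChartAt_symm (I := I) ((extChartAt I x).map_source hy')
    rwa [I.range_eq_univ, mdifferentiableWithinAt_univ] at this
  rw [coordField, TangentBundle.symmL_trivializationAt hy, I.range_eq_univ, mfderivWithin_univ,
    ← mfderiv_eq_fderiv]
  exact (mfderiv_comp_apply_of_eq (I' := I) _ hg hs ((extChartAt I x).left_inv hy') v).symm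

end Charts

/-! ### Orthogonal projections as smooth functions of a frame. -/

section Projection

variable {𝕜 W : Type*} [RCLike 𝕜] [NormedAddCommGroup W] [InnerProductSpace 𝕜 W]

theorem isUnit_adjoint_comp_self {V : Type*} [NormedAddCommGroup V] [InnerProductSpace 𝕜 V]
    [FiniteDimensional 𝕜 V] [CompleteSpace V] [CompleteSpace W]
    {Φ : V →L[𝕜] W} (hΦ : Function.Injective Φ) : IsUnit (Φ.adjoint ∘L Φ : V →L[𝕜] V) := by
  have hinj : Function.Injective (Φ.adjoint ∘L Φ : V →L[𝕜] V) := by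
    rw [injective_iff_map_eq_zero]
    intro v hv
    apply hΦ
    rw [map_zero, ← inner_self_eq_zero (𝕜 := 𝕜), ← ContinuousLinearMap.adjoint_inner_right]
    rw [ContinuousLinearMap.comp_apply] at hv
    rw [hv, inner_zero_right]
  let e := (LinearEquiv.ofInjectiveEndo _ hinj).toContinuousLinearEquiv
  exact ⟨ContinuousLinearEquiv.toUnit e, rfl⟩

/-- The Gram matrix of an injective `Φ` is invertible, so this is the least-squares formula. It
shows that the projection depends smoothly on the frame, even if the frame is not orthonormal. -/
theorem starProjection_range_eq {V : Type*} [NormedAddCommGroup V] [InnerProductSpace 𝕜 V]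
    [FiniteDimensional 𝕜 V] [CompleteSpace V] [CompleteSpace W]
    {Φ : V →L[𝕜] W} (hΦ : Function.Injective Φ) :
    (LinearMap.range (Φ : V →ₗ[𝕜] W)).starProjection =
      Φ ∘L Ring.inverse (Φ.adjoint ∘L Φ) ∘L Φ.adjoint := by
  have hu := isUnit_adjoint_comp_self hΦ
  ext w
  refine Submodule.eq_starProjection_of_mem_of_inner_eq_zero ⟨_, rfl⟩ ?_
  rintro _ ⟨v, rfl⟩
  have h := congrArg (fun T : V →L[𝕜] V => T (Φ.adjoint w)) (Ring.mul_inverse_cancel _ hu)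
  simp only [mul_apply_eq_comp, ContinuousLinearMap.comp_apply] at h
  rw [ContinuousLinearMap.coe_coe, ← ContinuousLinearMap.adjoint_inner_left, map_sub]
  simp only [ContinuousLinearMap.comp_apply]
  rw [h]
  simp

/-- Taking adjoints is conjugate-linear, hence smooth only over `ℝ`; this is why all smoothness is
reduced to real scalars. -/
theorem contDiff_adjoint {V : Type*} [NormedAddCommGroup V] [InnerProductSpace 𝕜 V]
    [FiniteDimensional 𝕜 V] [CompleteSpace V] [CompleteSpace W]
    [NormedSpace ℝ V] [IsScalarTower ℝ 𝕜 V] [NormedSpace ℝ W] [IsScalarTower ℝ 𝕜 W] :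
    ContDiff ℝ ∞ (ContinuousLinearMap.adjoint : (V →L[𝕜] W) → (W →L[𝕜] V)) := by
  let L : (V →L[𝕜] W) →ₗᵢ[ℝ] (W →L[𝕜] V) :=
    { toFun := fun Φ => Φ.adjoint
      map_add' := fun Φ Ψ => map_add _ Φ Ψ
      map_smul' := fun r Φ => by
        rw [RCLike.real_smul_eq_coe_smul (K := 𝕜) r Φ, map_smulₛₗ, RCLike.conj_ofReal]
        exact (RCLike.real_smul_eq_coe_smul (K := 𝕜) r _).symm
      norm_map' := fun Φ => LinearIsometryEquiv.norm_map _ Φ }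
  exact L.toContinuousLinearMap.contDiff

theorem contDiff_clm_comp_restrictScalars {V₁ V₂ V₃ X : Type*}
    [NormedAddCommGroup V₁] [NormedSpace 𝕜 V₁] [NormedAddCommGroup V₂] [NormedSpace 𝕜 V₂]
    [NormedAddCommGroup V₃] [NormedSpace 𝕜 V₃] [NormedSpace ℝ V₂] [IsScalarTower ℝ 𝕜 V₂]
    [NormedSpace ℝ V₃] [IsScalarTower ℝ 𝕜 V₃] [NormedAddCommGroup X] [NormedSpace ℝ X]
    {n : ℕ∞ω} {g : X → V₂ →L[𝕜] V₃} {f : X → V₁ →L[𝕜] V₂} (hg : ContDiff ℝ n g)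
    (hf : ContDiff ℝ n f) : ContDiff ℝ n fun x => g x ∘L f x :=
  ((isBoundedBilinearMap_comp (𝕜 := 𝕜) (E := V₁) (F := V₂) (G := V₃)).contDiff.restrict_scalars
    ℝ).comp (hg.prodMk hf)

end Projection

/-! ### Smoothness of the projection onto the tautological plane. -/

namespace Gr

section Smooth

variable {𝕜 W : Type*} [RCLike 𝕜] [NormedAddCommGroup W] [InnerProductSpace 𝕜 W]
  [FiniteDimensional 𝕜 W] {p : ℕ}

theorem extChartAt_symm_apply (x : Gr 𝕜 W p) (A : GrModel 𝕜 W p) :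
    (extChartAt 𝓘(ℝ, GrModel 𝕜 W p) x).symm A = mk (x.graphFrame A) := rfl

theorem extChartAt_apply (x y : Gr 𝕜 W p) :
    extChartAt 𝓘(ℝ, GrModel 𝕜 W p) x y =
      x.coordQ ∘L y.frame ∘L Ring.inverse (x.coordS ∘L y.frame) := rfl

theorem extChartAt_target (x : Gr 𝕜 W p) :
    (extChartAt 𝓘(ℝ, GrModel 𝕜 W p) x).target = Set.univ := by
  simp only [mfld_simps]; rfl

theorem extChartAt_self (x : Gr 𝕜 W p) : extChartAt 𝓘(ℝ, GrModel 𝕜 W p) x x = 0 := by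
  rw [extChartAt_apply]
  ext1 c
  simp [coordQ_frame]

/-- The orthogonal projection to the graph of the linear map `S_x → Q_x` with matrix `A`. -/
noncomputable def graphProj (x : Gr 𝕜 W p) (A : GrModel 𝕜 W p) : W →L[𝕜] W :=
  (mk (x.graphFrame A)).plane.starProjection

theorem graphProj_eq (x : Gr 𝕜 W p) [CompleteSpace W] (A : GrModel 𝕜 W p) :
    x.graphProj A = (x.frame + x.coframe ∘L A) ∘L
      Ring.inverse ((x.frame + x.coframe ∘L A).adjoint ∘L (x.frame + x.coframe ∘L A)) ∘L
        (x.frame + x.coframe ∘L A).adjoint := by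
  refine Eq.trans ?_ (starProjection_range_eq (x.graphFrame A).2)
  rw [graphProj]
  congr 1
  exact plane_mk _

theorem starProjection_comp_extChartAt_symm (x : Gr 𝕜 W p) :
    (fun y : Gr 𝕜 W p => y.plane.starProjection) ∘ (extChartAt 𝓘(ℝ, GrModel 𝕜 W p) x).symm =
      x.graphProj := rfl

variable [NormedSpace ℝ W] [IsScalarTower ℝ 𝕜 W]

theorem contDiff_graphProj (x : Gr 𝕜 W p) : ContDiff ℝ ∞ x.graphProj := by
  have : CompleteSpace W := FiniteDimensional.complete 𝕜 W
  rw [show x.graphProj = _ from funext x.graphProj_eq]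
  have h1 : ContDiff ℝ ∞ (fun A : GrModel 𝕜 W p => x.frame + x.coframe ∘L A) := by
    have : ContDiff 𝕜 ∞ (fun A : GrModel 𝕜 W p => x.frame + x.coframe ∘L A) := by fun_prop
    exact this.restrict_scalars ℝ
  have h2 : ContDiff ℝ ∞ (fun A : GrModel 𝕜 W p => (x.frame + x.coframe ∘L A).adjoint) :=
    contDiff_adjoint.comp h1
  have h3 : ContDiff ℝ ∞ (fun A : GrModel 𝕜 W p =>
      Ring.inverse ((x.frame + x.coframe ∘L A).adjoint ∘L (x.frame + x.coframe ∘L A))) := by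
    refine contDiff_iff_contDiffAt.2 fun A => ?_
    obtain ⟨u, hu⟩ := isUnit_adjoint_comp_self (x.graphFrame A).2
    have hinv := (contDiffAt_ringInverse 𝕜 u (n := ∞)).restrict_scalars ℝ
    rw [hu] at hinv
    exact ContDiffAt.comp (g := Ring.inverse) A hinv
      (contDiff_clm_comp_restrictScalars h2 h1).contDiffAt
  exact contDiff_clm_comp_restrictScalars h1 (contDiff_clm_comp_restrictScalars h3 h2)

theorem contMDiff_starProjection_plane :
    ContMDiff 𝓘(ℝ, GrModel 𝕜 W p) 𝓘(ℝ, W →L[𝕜] W) ∞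
      (fun y : Gr 𝕜 W p => y.plane.starProjection) := by
  intro x
  have h : ContMDiffAt 𝓘(ℝ, GrModel 𝕜 W p) 𝓘(ℝ, W →L[𝕜] W) ∞
      (x.graphProj ∘ extChartAt 𝓘(ℝ, GrModel 𝕜 W p) x) x :=
    x.contDiff_graphProj.contMDiff.contMDiffAt.comp x contMDiffAt_extChartAt
  refine h.congr_of_eventuallyEq ?_
  filter_upwards [extChartAt_source_mem_nhds (I := 𝓘(ℝ, GrModel 𝕜 W p)) x] with y hy
  rw [← starProjection_comp_extChartAt_symm]
  simp only [Function.comp_apply]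
  rw [(extChartAt 𝓘(ℝ, GrModel 𝕜 W p) x).left_inv hy]

end Smooth

end Gr

/-! ### Product rules along real curves of `𝕜`-linear operators. -/

section Curves

variable {𝕜 W : Type*} [RCLike 𝕜] [NormedAddCommGroup W] [InnerProductSpace 𝕜 W]
  [NormedSpace ℝ W] [IsScalarTower ℝ 𝕜 W]

theorem HasDerivAt.clm_apply_restrictScalars {α : ℝ → W →L[𝕜] W} {α' : W →L[𝕜] W} {β : ℝ → W}
    {β' : W} {s : ℝ} (hα : HasDerivAt α α' s) (hβ : HasDerivAt β β' s) :
    HasDerivAt (fun s => α s (β s)) (α' (β s) + α s β') s :=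
  HasDerivAt.clm_apply (c := fun s => (α s).restrictScalars ℝ) (c' := α'.restrictScalars ℝ)
    ((ContinuousLinearMap.restrictScalarsL 𝕜 W W ℝ ℝ).hasFDerivAt.comp_hasDerivAt s hα) hβ

theorem HasDerivAt.clm_apply_const {α : ℝ → W →L[𝕜] W} {α' : W →L[𝕜] W}
    {s : ℝ} (hα : HasDerivAt α α' s) (w : W) : HasDerivAt (fun s => α s w) (α' w) s := by
  simpa using hα.clm_apply_restrictScalars (hasDerivAt_const s w)

theorem inner_apply_eq_of_hasDerivAt {α : ℝ → W →L[𝕜] W} {α' : W →L[𝕜] W} {s : ℝ}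
    (hα : HasDerivAt α α' s)
    (hsymm : ∀ s w w', inner 𝕜 (α s w) w' = inner 𝕜 w (α s w')) (w w' : W) :
    inner 𝕜 (α' w) w' = inner 𝕜 w (α' w') := by
  have h1 := (hα.clm_apply_const w).inner 𝕜 (hasDerivAt_const s w')
  have h2 := (hasDerivAt_const s w).inner 𝕜 (hα.clm_apply_const w')
  simp only [hsymm] at h1
  simpa using h1.unique h2

end Curves

/-! ### Algebra of the block decomposition of `W` into `S_x` and `Q_x`. -/

namespace Gr

section Linear

variable {𝕜 W : Type*} [RCLike 𝕜] [NormedAddCommGroup W] [InnerProductSpace 𝕜 W]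
  [FiniteDimensional 𝕜 W] {p : ℕ}

/-- The linear map `S_x → Q_x` with matrix `X`, extended by zero on `Q_x` to an endomorphism
of `W`. -/
noncomputable def homExt (x : Gr 𝕜 W p) (X : GrModel 𝕜 W p) : W →L[𝕜] W :=
  x.coframe ∘L X ∘L x.coordS

theorem homExt_apply (x : Gr 𝕜 W p) (X : GrModel 𝕜 W p) (w : W) :
    x.homExt X w = x.coframe (X (x.coordS w)) := rfl

theorem coe_tangentToHom (x : Gr 𝕜 W p) (X : GrModel 𝕜 W p) (s : x.plane) :
    (x.tangentToHom X s : W) = x.homExt X s := by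
  simp [tangentToHom, homExt_apply, coframe, coordS]

theorem coframe_mem (x : Gr 𝕜 W p) (c : EuclideanSpace 𝕜 (Fin (Module.finrank 𝕜 W - p))) :
    x.coframe c ∈ (x.plane)ᗮ :=
  (x.coframeEquiv.symm c).2

omit [FiniteDimensional 𝕜 W] in
theorem frame_mem (x : Gr 𝕜 W p) (c : EuclideanSpace 𝕜 (Fin p)) : x.frame c ∈ x.plane :=
  ⟨c, rfl⟩

theorem starProjection_coframe (x : Gr 𝕜 W p)
    (c : EuclideanSpace 𝕜 (Fin (Module.finrank 𝕜 W - p))) :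
    x.plane.starProjection (x.coframe c) = 0 :=
  Submodule.starProjection_apply_eq_zero_iff _ |>.2 (x.coframe_mem c)

theorem frame_coordS (x : Gr 𝕜 W p) (w : W) :
    x.frame (x.coordS w) = x.plane.starProjection w := by
  refine (Submodule.eq_starProjection_of_mem_orthogonal (x.frame_mem _) ?_).symm
  nth_rw 1 [← x.frame_comp_coordS_add w]
  rw [add_sub_cancel_left]
  exact x.coframe_mem _

theorem starProjection_homExt (x : Gr 𝕜 W p) (X : GrModel 𝕜 W p) (w : W) :
    x.plane.starProjection (x.homExt X w) = 0 :=
  x.starProjection_coframe _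

theorem homExt_starProjection (x : Gr 𝕜 W p) (X : GrModel 𝕜 W p) (w : W) :
    x.homExt X (x.plane.starProjection w) = x.homExt X w := by
  rw [← frame_coordS, homExt_apply, coordS_frame, homExt_apply]

theorem homExt_eq_zero_iff (x : Gr 𝕜 W p) (X : GrModel 𝕜 W p) : x.homExt X = 0 ↔ X = 0 := by
  refine ⟨fun h => ?_, fun h => by ext; simp [h, homExt_apply]⟩
  ext1 c
  have := congrArg (fun T : W →L[𝕜] W => x.coordQ (T (x.frame c))) h
  simpa [homExt_apply, coordQ_coframe, coordS_frame] using this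

theorem homExt_sub (x : Gr 𝕜 W p) (X Y : GrModel 𝕜 W p) :
    x.homExt (X - Y) = x.homExt X - x.homExt Y := by
  ext w; simp [homExt_apply]

theorem homExt_sum (x : Gr 𝕜 W p) {ι : Type*} (s : Finset ι) (X : ι → GrModel 𝕜 W p) :
    x.homExt (∑ i ∈ s, X i) = ∑ i ∈ s, x.homExt (X i) := by
  ext w; simp [homExt_apply]

theorem graphProj_zero (x : Gr 𝕜 W p) : x.graphProj 0 = x.plane.starProjection := by
  rw [← extChartAt_self x, ← starProjection_comp_extChartAt_symm, Function.comp_apply,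
    (extChartAt 𝓘(ℝ, GrModel 𝕜 W p) x).left_inv (mem_extChartAt_source x)]

theorem graphProj_graphProj (x : Gr 𝕜 W p) (A : GrModel 𝕜 W p) (w : W) :
    x.graphProj A (x.graphProj A w) = x.graphProj A w :=
  Submodule.starProjection_eq_self_iff.2 (Submodule.starProjection_apply_mem _ w)

/-- Together with idempotence and symmetry, this is all that is used about the projection when it is
differentiated; the explicit formula with the inverse Gram matrix serves only for smoothness. -/
theorem graphProj_graphFrame (x : Gr 𝕜 W p) (A : GrModel 𝕜 W p) (c : EuclideanSpace 𝕜 (Fin p)) :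
    x.graphProj A (x.frame c + x.coframe (A c)) = x.frame c + x.coframe (A c) := by
  refine Submodule.starProjection_eq_self_iff.2 ?_
  rw [plane_mk]
  exact ⟨c, rfl⟩

theorem inner_graphProj (x : Gr 𝕜 W p) (A : GrModel 𝕜 W p) (w w' : W) :
    inner 𝕜 (x.graphProj A w) w' = inner 𝕜 w (x.graphProj A w') :=
  Submodule.inner_starProjection_left_eq_right _ w w'

end Linear

/-! ### First and second derivatives of the projection along a curve of planes. -/

section Derivatives

variable {𝕜 W : Type*} [RCLike 𝕜] [NormedAddCommGroup W] [InnerProductSpace 𝕜 W]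
  [NormedSpace ℝ W] [IsScalarTower ℝ 𝕜 W] [FiniteDimensional 𝕜 W] {p : ℕ}

theorem hasDerivAt_graphFrame (x : Gr 𝕜 W p) {γ : ℝ → GrModel 𝕜 W p} {γ' : GrModel 𝕜 W p} {s : ℝ}
    (hγ : HasDerivAt γ γ' s) (c : EuclideanSpace 𝕜 (Fin p)) :
    HasDerivAt (fun s => x.frame c + x.coframe (γ s c)) (x.coframe (γ' c)) s := by
  have h1 : HasDerivAt (fun s => x.coframe (γ s c)) (x.coframe (γ' c)) s := by
    let L : GrModel 𝕜 W p →L[𝕜] W :=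
      x.coframe ∘L ContinuousLinearMap.apply 𝕜 _ c
    exact (L.restrictScalars ℝ).hasFDerivAt.comp_hasDerivAt s hγ
  exact h1.const_add _

section First

variable {x : Gr 𝕜 W p} {γ : ℝ → GrModel 𝕜 W p} {γ' : GrModel 𝕜 W p} {α' : W →L[𝕜] W} {s : ℝ}

theorem hasDerivAt_graphProj_idem (hα : HasDerivAt (fun s => x.graphProj (γ s)) α' s) (w : W) :
    α' (x.graphProj (γ s) w) + x.graphProj (γ s) (α' w) = α' w := by
  have h1 := hα.clm_apply_restrictScalars (hα.clm_apply_const w)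
  simp only [graphProj_graphProj] at h1
  exact h1.unique (hα.clm_apply_const w)

theorem hasDerivAt_graphProj_frame (hα : HasDerivAt (fun s => x.graphProj (γ s)) α' s)
    (hγ : HasDerivAt γ γ' s) (c : EuclideanSpace 𝕜 (Fin p)) :
    α' (x.frame c + x.coframe (γ s c)) + x.graphProj (γ s) (x.coframe (γ' c)) =
      x.coframe (γ' c) := by
  have h1 := hα.clm_apply_restrictScalars (x.hasDerivAt_graphFrame hγ c)
  simp only [graphProj_graphFrame] at h1
  exact h1.unique (x.hasDerivAt_graphFrame hγ c)

theorem hasDerivAt_graphProj_symm (hα : HasDerivAt (fun s => x.graphProj (γ s)) α' s) (w w' : W) :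
    inner 𝕜 (α' w) w' = inner 𝕜 w (α' w') :=
  inner_apply_eq_of_hasDerivAt hα (fun _ _ _ => x.inner_graphProj _ _ _) w w'

end First

/-- The second derivative of the orthogonal projection to the planes of a curve. -/
theorem second_deriv_graphProj {x : Gr 𝕜 W p} {γ γ₁ : ℝ → GrModel 𝕜 W p} {γ₂ : GrModel 𝕜 W p}
    {α₁ : ℝ → W →L[𝕜] W} {α₂ : W →L[𝕜] W} (h0 : γ 0 = 0)
    (hγ : ∀ᶠ s in 𝓝 0, HasDerivAt γ (γ₁ s) s) (hγ₁ : HasDerivAt γ₁ γ₂ 0)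
    (hα : ∀ᶠ s in 𝓝 0, HasDerivAt (fun s => x.graphProj (γ s)) (α₁ s) s)
    (hα₁ : HasDerivAt α₁ α₂ 0) (w : W) :
    α₂ w - x.plane.starProjection (α₂ w) = x.homExt γ₂ w +
      (2 : ℝ) • (α₁ 0 (α₁ 0 w) - x.plane.starProjection (α₁ 0 (α₁ 0 w))) := by
  set P := x.plane.starProjection with hP
  have hP0 : x.graphProj (γ 0) = P := by rw [h0, graphProj_zero]
  have hα0 := hα.self_of_nhds
  have hγ0 := hγ.self_of_nhds
  have idem (w : W) : α₁ 0 (P w) + P (α₁ 0 w) = α₁ 0 w := by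
    simpa only [hP0] using hasDerivAt_graphProj_idem hα0 w
  have hPP (w : W) : P (P w) = P w := by
    simpa only [hP0] using x.graphProj_graphProj (γ 0) w
  -- The second derivative of `P² = P`, obtained by differentiating the first-order identity, which
  -- holds near `0`.
  have idem₂ (w : W) : α₂ (P w) + (2 : ℝ) • α₁ 0 (α₁ 0 w) + P (α₂ w) = α₂ w := by
    have h1 := (hα₁.clm_apply_restrictScalars (hα0.clm_apply_const w)).add
      (hα0.clm_apply_restrictScalars (hα₁.clm_apply_const w))
    have h2 := h1.congr_of_eventuallyEq (f₁ := fun s => α₁ s w)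
      (by filter_upwards [hα] with s hs using (hasDerivAt_graphProj_idem hs w).symm)
    have h3 := h2.unique (hα₁.clm_apply_const w)
    rw [hP0] at h3
    refine Eq.trans ?_ h3
    rw [two_smul]
    abel
  -- The second derivative of the identity saying that the projection fixes the moving frame. The
  -- term `P (x.coframe (γ₂ c))` drops out because `γ 0 = 0` makes `P` the projection onto `S_x`.
  have frame₂ (c : EuclideanSpace 𝕜 (Fin p)) :
      α₂ (x.frame c) + (2 : ℝ) • α₁ 0 (x.coframe (γ₁ 0 c)) = x.coframe (γ₂ c) := by
    have hc : HasDerivAt (fun s => x.coframe (γ₁ s c)) (x.coframe (γ₂ c)) 0 := by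
      simpa using (x.hasDerivAt_graphFrame hγ₁ c).sub_const (x.frame c)
    have h1 := (hα₁.clm_apply_restrictScalars (x.hasDerivAt_graphFrame hγ0 c)).add
      (hα0.clm_apply_restrictScalars hc)
    have h2 := h1.congr_of_eventuallyEq (f₁ := fun s => x.coframe (γ₁ s c))
      (by filter_upwards [hα, hγ] with s hs hs' using (hasDerivAt_graphProj_frame hs hs' c).symm)
    have h3 := h2.unique hc
    rw [hP0, h0] at h3
    simp only [zero_apply, map_zero, add_zero, hP, starProjection_coframe] at h3
    refine Eq.trans ?_ h3
    rw [two_smul]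
    abel
  have key : α₂ (P w) = x.homExt γ₂ w - (2 : ℝ) • α₁ 0 (x.homExt (γ₁ 0) w) := by
    rw [eq_sub_iff_add_eq, hP, ← frame_coordS]
    exact frame₂ _
  -- The first derivative of a projection exchanges its range and its kernel, so it sends this
  -- vector of `Q_x` into `S_x`.
  have hQ : P (α₁ 0 (x.homExt (γ₁ 0) w)) = α₁ 0 (x.homExt (γ₁ 0) w) := by
    have := idem (x.homExt (γ₁ 0) w)
    rwa [hP, starProjection_homExt, map_zero, zero_add] at this
  have hP2 (v : W) : P ((2 : ℝ) • v) = (2 : ℝ) • P v := by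
    rw [two_smul, two_smul, map_add]
  have h4 := idem₂ w
  rw [key] at h4
  have h5 := congrArg P h4
  simp only [map_add, map_sub, hP2, hQ, hPP] at h5
  rw [hP, starProjection_homExt, ← hP, zero_sub] at h5
  -- The `S_x`-component of the twice differentiated idempotence; `P (α₂ w)` cancels on both sides.
  have h6 : (2 : ℝ) • α₁ 0 (x.homExt (γ₁ 0) w) = (2 : ℝ) • P (α₁ 0 (α₁ 0 w)) := by
    have h7 : (-((2 : ℝ) • α₁ 0 (x.homExt (γ₁ 0) w)) + (2 : ℝ) • P (α₁ 0 (α₁ 0 w))) = 0 := by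
      simpa using h5
    rwa [neg_add_eq_zero] at h7
  rw [h6] at h4
  rw [smul_sub, sub_eq_iff_eq_add]
  refine h4.symm.trans ?_
  abel

end Derivatives

end Gr

/-- No differentiability is assumed: where it fails, `fderiv` takes the default value zero. -/
theorem fderiv_zero_of_even {V V' : Type*} [NormedAddCommGroup V] [NormedSpace ℝ V]
    [NormedAddCommGroup V'] [NormedSpace ℝ V'] {h : V → V'} (hh : ∀ v, h (-v) = h v) :
    fderiv ℝ h 0 = 0 := by
  by_cases hd : DifferentiableAt ℝ h 0
  · have h1 : HasFDerivAt h (fderiv ℝ h 0 ∘L (-ContinuousLinearMap.id ℝ V)) 0 := by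
      have h2 : HasFDerivAt h (fderiv ℝ h 0) (-(0 : V)) := by simpa using hd.hasFDerivAt
      have h3 := h2.comp (0 : V) (hasFDerivAt_id (0 : V)).neg
      exact h3.congr_of_eventuallyEq (Filter.Eventually.of_forall fun v => (hh v).symm)
    have h4 := hd.hasFDerivAt.unique h1
    ext v
    have h5 : fderiv ℝ h 0 v = -fderiv ℝ h 0 v := by
      conv_lhs => rw [h4]
      simp
    have h6 : (2 : ℝ) • fderiv ℝ h 0 v = 0 := by
      rw [two_smul]; nth_rw 1 [h5]; exact neg_add_cancel _
    exact (smul_eq_zero.1 h6).resolve_left two_ne_zero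
  · exact fderiv_zero_of_not_differentiableAt hd

/-- Transfers the identities proved along curves to directional derivatives at a point. -/
theorem exists_hasDerivAt_eq {V : Type*} [NormedAddCommGroup V] [NormedSpace ℝ V] (a v : V) :
    ∃ γ : ℝ → V, γ 0 = a ∧ HasDerivAt γ v 0 :=
  ⟨fun s => a + s • v, by simp, by simpa using ((hasDerivAt_id (0 : ℝ)).smul_const v).const_add a⟩

/-! ### The reflection in a plane and the evenness of the metric in the graph chart. -/

namespace Gr

section Reflection

variable {𝕜 W : Type*} [RCLike 𝕜] [NormedAddCommGroup W] [InnerProductSpace 𝕜 W]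
  [FiniteDimensional 𝕜 W] {p : ℕ}

theorem reflection_coframe (x : Gr 𝕜 W p)
    (c : EuclideanSpace 𝕜 (Fin (Module.finrank 𝕜 W - p))) :
    x.plane.reflection (x.coframe c) = -x.coframe c := by
  rw [Submodule.reflection_apply, starProjection_coframe, smul_zero, zero_sub]

theorem reflection_frame (x : Gr 𝕜 W p) (c : EuclideanSpace 𝕜 (Fin p)) :
    x.plane.reflection (x.frame c) = x.frame c :=
  Submodule.reflection_mem_subspace_eq_self (x.frame_mem c)

theorem reflection_homExt (x : Gr 𝕜 W p) (X : GrModel 𝕜 W p) (w : W) :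
    x.plane.reflection (x.homExt X w) = -x.homExt X w :=
  x.reflection_coframe _

theorem homExt_reflection (x : Gr 𝕜 W p) (X : GrModel 𝕜 W p) (w : W) :
    x.homExt X (x.plane.reflection w) = x.homExt X w := by
  rw [Submodule.reflection_apply, two_smul, map_sub, map_add, homExt_starProjection]
  abel

theorem inner_reflection_left (x : Gr 𝕜 W p) (w w' : W) :
    inner 𝕜 (x.plane.reflection w) w' = inner 𝕜 w (x.plane.reflection w') := by
  conv_rhs => rw [← LinearIsometryEquiv.inner_map_map x.plane.reflection]
  rw [Submodule.reflection_reflection]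

/-- The reflection in the plane `x` maps the graph of `A` to the graph of `-A`. -/
theorem graphProj_neg (x : Gr 𝕜 W p) (A : GrModel 𝕜 W p) (w : W) :
    x.graphProj (-A) w =
      x.plane.reflection (x.graphProj A (x.plane.reflection w)) := by
  have hR (c : EuclideanSpace 𝕜 (Fin p)) : x.plane.reflection (x.frame c + x.coframe (A c)) =
      x.frame c + x.coframe ((-A) c) := by
    rw [map_add, reflection_frame, reflection_coframe]
    simp
  have hmem : x.graphProj A (x.plane.reflection w) ∈ (mk (x.graphFrame A)).plane :=
    Submodule.starProjection_apply_mem _ _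
  rw [plane_mk] at hmem
  obtain ⟨c, hc⟩ := hmem
  have hc' : x.frame c + x.coframe (A c) = x.graphProj A (x.plane.reflection w) := hc
  refine Submodule.eq_starProjection_of_mem_of_inner_eq_zero ?_ fun v hv => ?_
  · rw [plane_mk, ← hc', hR]
    exact ⟨c, rfl⟩
  · rw [plane_mk] at hv
    obtain ⟨c', rfl⟩ := hv
    have hv' : ((x.graphFrame (-A)).1 : EuclideanSpace 𝕜 (Fin p) →ₗ[𝕜] W) c' =
      x.plane.reflection (x.frame c' + x.coframe (A c')) := (hR c').symm
    rw [hv', ← inner_reflection_left, map_sub, Submodule.reflection_reflection]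
    refine Submodule.starProjection_inner_eq_zero _ _ ?_
    rw [plane_mk]
    exact ⟨c', rfl⟩

/-- By `fubiniStudyInner_eq_trace` and `coe_tangentToHom_coordField`, the real part of this trace is
a metric coefficient of the graph chart. The reflection conjugates one operator into the other,
since it conjugates the two projections and its signs on `homExt` and on the adjoint cancel. -/
theorem trace_homExt_graphProj_neg (x : Gr 𝕜 W p) (X Y A : GrModel 𝕜 W p) :
    LinearMap.trace 𝕜 W ((x.homExt X : W →ₗ[𝕜] W).adjoint ∘ₗ
        (LinearMap.id - (x.graphProj (-A) : W →ₗ[𝕜] W)) ∘ₗ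
          (x.homExt Y : W →ₗ[𝕜] W) ∘ₗ (x.graphProj (-A) : W →ₗ[𝕜] W)) =
      LinearMap.trace 𝕜 W ((x.homExt X : W →ₗ[𝕜] W).adjoint ∘ₗ
        (LinearMap.id - (x.graphProj A : W →ₗ[𝕜] W)) ∘ₗ
          (x.homExt Y : W →ₗ[𝕜] W) ∘ₗ (x.graphProj A : W →ₗ[𝕜] W)) := by
  conv_rhs => rw [← LinearMap.trace_conj' _ x.plane.reflection.toLinearEquiv]
  congr 1
  set S := (x.homExt X : W →ₗ[𝕜] W).adjoint with hS
  -- The range of `homExt` lies in `Q_x`, so its adjoint kills `S_x`; likewise `homExt` kills `Q_x`,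
  -- so the range of the adjoint lies in `S_x`, which gives `h2`.
  have h1 (w : W) : S (x.plane.reflection w) = -S w := by
    refine ext_inner_right 𝕜 fun v => ?_
    rw [hS, LinearMap.adjoint_inner_left, ContinuousLinearMap.coe_coe, inner_reflection_left,
      reflection_homExt, inner_neg_right, inner_neg_left, LinearMap.adjoint_inner_left]
    rfl
  have h2 (w : W) : x.plane.reflection (S w) = S w := by
    refine ext_inner_right 𝕜 fun v => ?_
    rw [inner_reflection_left, hS, LinearMap.adjoint_inner_left, ContinuousLinearMap.coe_coe,
      homExt_reflection, LinearMap.adjoint_inner_left]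
    rfl
  ext w
  have hL : (x.plane.reflection.toLinearEquiv.conj (S ∘ₗ
      (LinearMap.id - (x.graphProj A : W →ₗ[𝕜] W)) ∘ₗ
          (x.homExt Y : W →ₗ[𝕜] W) ∘ₗ (x.graphProj A : W →ₗ[𝕜] W))) w =
      x.plane.reflection (S (x.homExt Y (x.graphProj A (x.plane.reflection w)) -
        x.graphProj A (x.homExt Y (x.graphProj A (x.plane.reflection w))))) := by
    rw [LinearEquiv.conj_apply_apply]
    rfl
  rw [hL, h2]
  simp only [LinearMap.comp_apply, LinearMap.sub_apply, LinearMap.id_apply,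
    ContinuousLinearMap.coe_coe, graphProj_neg, homExt_reflection, reflection_homExt, map_neg,
    map_sub, map_add, h1, sub_neg_eq_add]
  abel

/-- A formula for the metric in terms of the trace over `W`. -/
theorem fubiniStudyInner_eq_trace (y : Gr 𝕜 W p) {X Y : GrModel 𝕜 W p} {S T : W →L[𝕜] W}
    (hX : ∀ s : y.plane, (y.tangentToHom X s : W) = S s - y.plane.starProjection (S s))
    (hY : ∀ s : y.plane, (y.tangentToHom Y s : W) = T s - y.plane.starProjection (T s)) :
    y.fubiniStudyInner X Y = RCLike.re (LinearMap.trace 𝕜 W ((S : W →ₗ[𝕜] W).adjoint ∘ₗ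
        (LinearMap.id - (y.plane.starProjection : W →ₗ[𝕜] W)) ∘ₗ
          (T : W →ₗ[𝕜] W) ∘ₗ (y.plane.starProjection : W →ₗ[𝕜] W))) := by
  have h1 : LinearMap.trace 𝕜 W ((S : W →ₗ[𝕜] W).adjoint ∘ₗ
        (LinearMap.id - (y.plane.starProjection : W →ₗ[𝕜] W)) ∘ₗ
          (T : W →ₗ[𝕜] W) ∘ₗ (y.plane.starProjection : W →ₗ[𝕜] W)) =
      LinearMap.trace 𝕜 y.plane ((y.plane.orthogonalProjectionOnto : W →ₗ[𝕜] y.plane) ∘ₗ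
        ((S : W →ₗ[𝕜] W).adjoint ∘ₗ
        (LinearMap.id - (y.plane.starProjection : W →ₗ[𝕜] W)) ∘ₗ
          (T : W →ₗ[𝕜] W) ∘ₗ y.plane.subtype)) :=
    -- The last factor is the projection onto the plane followed by the inclusion; cyclicity moves
    -- the projection to the front and leaves a trace over the plane.
    (LinearMap.trace_comp_comm' (y.plane.orthogonalProjectionOnto : W →ₗ[𝕜] y.plane)
      ((S : W →ₗ[𝕜] W).adjoint ∘ₗ
        (LinearMap.id - (y.plane.starProjection : W →ₗ[𝕜] W)) ∘ₗ
          (T : W →ₗ[𝕜] W) ∘ₗ y.plane.subtype))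
  rw [h1, LinearMap.trace_eq_sum_inner _ (stdOrthonormalBasis 𝕜 y.plane), map_sum,
    fubiniStudyInner]
  refine Finset.sum_congr rfl fun j _ => congrArg RCLike.re ?_
  set s := stdOrthonormalBasis 𝕜 y.plane j
  have h2 (w : W) : inner 𝕜 s (y.plane.orthogonalProjectionOnto w) = inner 𝕜 (s : W) w :=
    Submodule.inner_orthogonalProjectionOnto_eq_of_mem_left s w
  simp only [LinearMap.comp_apply, ContinuousLinearMap.coe_coe, h2]
  rw [LinearMap.adjoint_inner_right, Submodule.coe_inner, hX, hY, inner_sub_left]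
  rw [show inner 𝕜 (y.plane.starProjection (S s)) (T s - y.plane.starProjection (T s)) = (0 : 𝕜)
    from Submodule.inner_right_of_mem_orthogonal (Submodule.starProjection_apply_mem _ _)
      (Submodule.sub_starProjection_mem_orthogonal _), sub_zero]
  rfl

end Reflection

/-! ### Second fundamental forms, trace of `H K`, and vanishing of the Christoffel symbols. -/

section Derivatives

variable {𝕜 W : Type*} [RCLike 𝕜] [NormedAddCommGroup W] [InnerProductSpace 𝕜 W]
  [NormedSpace ℝ W] [IsScalarTower ℝ 𝕜 W] [FiniteDimensional 𝕜 W] {p : ℕ}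

theorem hasDerivAt_graphProj_comp (x : Gr 𝕜 W p) {γ : ℝ → GrModel 𝕜 W p} {γ' : GrModel 𝕜 W p}
    {s : ℝ} (hγ : HasDerivAt γ γ' s) :
    HasDerivAt (fun s => x.graphProj (γ s)) (fderiv ℝ x.graphProj (γ s) γ') s :=
  (x.contDiff_graphProj.differentiable (by simp) (γ s)).hasFDerivAt.comp_hasDerivAt s hγ

theorem fderiv_graphProj_frame (x : Gr 𝕜 W p) (A v : GrModel 𝕜 W p)
    (c : EuclideanSpace 𝕜 (Fin p)) :
    fderiv ℝ x.graphProj A v (x.frame c + x.coframe (A c)) =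
      x.coframe (v c) - x.graphProj A (x.coframe (v c)) := by
  obtain ⟨γ, h0, hγ⟩ := exists_hasDerivAt_eq A v
  have := hasDerivAt_graphProj_frame (x.hasDerivAt_graphProj_comp hγ) hγ c
  rw [h0] at this
  exact eq_sub_of_add_eq this

theorem fderiv_graphProj_idem (x : Gr 𝕜 W p) (A v : GrModel 𝕜 W p) (w : W) :
    fderiv ℝ x.graphProj A v (x.graphProj A w) + x.graphProj A (fderiv ℝ x.graphProj A v w) =
      fderiv ℝ x.graphProj A v w := by
  obtain ⟨γ, rfl, hγ⟩ := exists_hasDerivAt_eq A v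
  exact hasDerivAt_graphProj_idem (x.hasDerivAt_graphProj_comp hγ) w

theorem inner_fderiv_graphProj (x : Gr 𝕜 W p) (A v : GrModel 𝕜 W p) (w w' : W) :
    inner 𝕜 (fderiv ℝ x.graphProj A v w) w' = inner 𝕜 w (fderiv ℝ x.graphProj A v w') := by
  obtain ⟨γ, rfl, hγ⟩ := exists_hasDerivAt_eq A v
  exact hasDerivAt_graphProj_symm (x.hasDerivAt_graphProj_comp hγ) w w'

/-- On `S_x` the derivative of the projection is the tangent vector itself, viewed in `Hom(S, Q)`;
by symmetry it is the adjoint on `Q_x`. -/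
theorem fderiv_graphProj_zero_plane (x : Gr 𝕜 W p) (X : GrModel 𝕜 W p) (w : W) :
    fderiv ℝ x.graphProj 0 X (x.plane.starProjection w) = x.homExt X w := by
  have := x.fderiv_graphProj_frame 0 X (x.coordS w)
  rw [zero_apply, map_zero, add_zero, frame_coordS, graphProj_zero, starProjection_coframe,
    sub_zero] at this
  exact this

theorem fderiv_graphProj_zero_apply (x : Gr 𝕜 W p) (X : GrModel 𝕜 W p) (s : x.plane) :
    fderiv ℝ x.graphProj 0 X s = x.tangentToHom X s := by
  rw [coe_tangentToHom, ← fderiv_graphProj_zero_plane,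
    Submodule.starProjection_eq_self_iff.2 s.2]

theorem inner_fderiv_graphProj_tangentToHom (x : Gr 𝕜 W p) (X : GrModel 𝕜 W p) (s : x.plane) :
    inner 𝕜 (s : W) (fderiv ℝ x.graphProj 0 X (x.tangentToHom X s)) =
      ((‖x.tangentToHom X s‖ ^ 2 : ℝ) : 𝕜) := by
  rw [← inner_fderiv_graphProj, fderiv_graphProj_zero_apply, ← Submodule.coe_inner,
    inner_self_eq_norm_sq_to_K]
  simp

theorem mdifferentiableAt_starProjection_plane (y : Gr 𝕜 W p) :
    MDifferentiableAt 𝓘(ℝ, GrModel 𝕜 W p) 𝓘(ℝ, W →L[𝕜] W)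
      (fun y : Gr 𝕜 W p => y.plane.starProjection) y :=
  contMDiff_starProjection_plane.mdifferentiableAt (by simp)

theorem mfderiv_starProjection_plane (x : Gr 𝕜 W p)
    (X : TangentSpace 𝓘(ℝ, GrModel 𝕜 W p) x) :
    mfderiv 𝓘(ℝ, GrModel 𝕜 W p) 𝓘(ℝ, W →L[𝕜] W)
      (fun y : Gr 𝕜 W p => y.plane.starProjection) x X = fderiv ℝ x.graphProj 0 X := by
  rw [mfderiv_eq_fderiv_comp_extChartAt_symm (mdifferentiableAt_starProjection_plane x),
    starProjection_comp_extChartAt_symm, extChartAt_self]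

theorem mfderiv_starProjection_plane_orthogonal (x : Gr 𝕜 W p)
    (X : TangentSpace 𝓘(ℝ, GrModel 𝕜 W p) x) :
    mfderiv 𝓘(ℝ, GrModel 𝕜 W p) 𝓘(ℝ, W →L[𝕜] W)
      (fun y : Gr 𝕜 W p => (y.plane)ᗮ.starProjection) x X = -fderiv ℝ x.graphProj 0 X := by
  have h (y : Gr 𝕜 W p) : (y.plane)ᗮ.starProjection =
      ContinuousLinearMap.id 𝕜 W - y.plane.starProjection := by
    ext w
    exact Submodule.starProjection_orthogonal_val w
  have hd : MDifferentiableAt 𝓘(ℝ, GrModel 𝕜 W p) 𝓘(ℝ, W →L[𝕜] W)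
      (fun y : Gr 𝕜 W p => (y.plane)ᗮ.starProjection) x := by
    simp_rw [h]
    exact mdifferentiableAt_const.sub (mdifferentiableAt_starProjection_plane x)
  rw [mfderiv_eq_fderiv_comp_extChartAt_symm hd, extChartAt_self,
    show (fun y : Gr 𝕜 W p => (y.plane)ᗮ.starProjection) ∘
        (extChartAt 𝓘(ℝ, GrModel 𝕜 W p) x).symm =
      fun A => ContinuousLinearMap.id 𝕜 W - x.graphProj A from funext fun A => h _,
    fderiv_const_sub]
  rfl

theorem coe_secondFormH (x : Gr 𝕜 W p) (X : TangentSpace 𝓘(ℝ, GrModel 𝕜 W p) x) (s : x.plane) :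
    (x.secondFormH X s : W) = x.homExt X s := by
  have h : (x.secondFormH X s : W) =
      (x.plane)ᗮ.starProjection (fderiv ℝ x.graphProj 0 X s) := by
    rw [← mfderiv_starProjection_plane]; rfl
  have h1 := x.fderiv_graphProj_zero_plane X s
  rw [Submodule.starProjection_eq_self_iff.2 s.2] at h1
  rw [h, h1, Submodule.starProjection_orthogonal_val]
  exact (congrArg (x.homExt X s - ·) (x.starProjection_homExt X s)).trans (sub_zero _)

theorem secondFormH_eq_tangentToHom (x : Gr 𝕜 W p) (X : TangentSpace 𝓘(ℝ, GrModel 𝕜 W p) x) :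
    x.secondFormH X = x.tangentToHom X := by
  ext s
  exact (x.coe_secondFormH X s).trans (x.coe_tangentToHom X s).symm

theorem coe_secondFormK (x : Gr 𝕜 W p) (X : TangentSpace 𝓘(ℝ, GrModel 𝕜 W p) x)
    (t : (x.plane)ᗮ) :
    (x.secondFormK X t : W) = -fderiv ℝ x.graphProj 0 X t := by
  have h : (x.secondFormK X t : W) =
      x.plane.starProjection ((-fderiv ℝ x.graphProj 0 X) t) := by
    rw [← mfderiv_starProjection_plane_orthogonal]; rfl
  have h1 := x.fderiv_graphProj_idem 0 X t
  rw [graphProj_zero, (Submodule.starProjection_apply_eq_zero_iff _).2 t.2, map_zero,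
    zero_add] at h1
  rw [h, neg_apply, map_neg, h1]

/-- Cyclicity moves the trace from `Q_x` to `S_x`, where `K_X = -X^*` turns each diagonal entry into
`-‖X s‖²`. -/
theorem trace_secondFormH_comp_secondFormK (x : Gr 𝕜 W p)
    (X : TangentSpace 𝓘(ℝ, GrModel 𝕜 W p) x) :
    LinearMap.trace 𝕜 (x.plane)ᗮ
      ((x.secondFormH X ∘L x.secondFormK X : (x.plane)ᗮ →L[𝕜] (x.plane)ᗮ) :
        (x.plane)ᗮ →ₗ[𝕜] (x.plane)ᗮ) = -((‖X‖ ^ 2 : ℝ) : 𝕜) := by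
  -- The norm of a tangent vector is the one of the Riemannian metric, not the operator norm of the
  -- matrix.
  have hn : ‖X‖ ^ 2 = x.fubiniStudyInner X X := by
    rw [← real_inner_self_eq_norm_sq]
    exact x.fubiniStudyForm_apply X X
  have h1 : LinearMap.trace 𝕜 (x.plane)ᗮ
      ((x.secondFormH X ∘L x.secondFormK X : (x.plane)ᗮ →L[𝕜] (x.plane)ᗮ) :
        (x.plane)ᗮ →ₗ[𝕜] (x.plane)ᗮ) =
      LinearMap.trace 𝕜 x.plane ((x.secondFormK X : (x.plane)ᗮ →ₗ[𝕜] x.plane) ∘ₗ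
        (x.secondFormH X : x.plane →ₗ[𝕜] (x.plane)ᗮ)) :=
    LinearMap.trace_comp_comm' (x.secondFormK X : (x.plane)ᗮ →ₗ[𝕜] x.plane)
      (x.secondFormH X : x.plane →ₗ[𝕜] (x.plane)ᗮ)
  rw [h1, LinearMap.trace_eq_sum_inner _ (stdOrthonormalBasis 𝕜 x.plane),
    hn.trans (x.fubiniStudyInner_self X), RCLike.ofReal_sum, ← Finset.sum_neg_distrib]
  refine Finset.sum_congr rfl fun j _ => ?_
  set s := stdOrthonormalBasis 𝕜 x.plane j
  rw [LinearMap.comp_apply, ContinuousLinearMap.coe_coe, ContinuousLinearMap.coe_coe,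
    Submodule.coe_inner, coe_secondFormK, inner_neg_right, secondFormH_eq_tangentToHom]
  exact congrArg Neg.neg (x.inner_fderiv_graphProj_tangentToHom X s)

/-- The derivative of the projection is computed twice: in the graph chart at `y` it recovers the
tangent vector as a map from `S_y` to `Q_y`, and in the chart at `x` it comes from the frame of the
graph. -/
theorem coe_tangentToHom_coordField (x : Gr 𝕜 W p) (v : TangentSpace 𝓘(ℝ, GrModel 𝕜 W p) x)
    (A : GrModel 𝕜 W p) {y : Gr 𝕜 W p} (hy : y = mk (x.graphFrame A)) (s : y.plane) :
    (y.tangentToHom (coordField 𝓘(ℝ, GrModel 𝕜 W p) x v y) s : W) =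
      x.homExt v s - y.plane.starProjection (x.homExt v s) := by
  obtain ⟨c, hc⟩ : ∃ c, x.frame c + x.coframe (A c) = s := by
    have hs := s.2
    simp only [hy, plane_mk] at hs
    exact hs
  have hsrc : y ∈ (extChartAt 𝓘(ℝ, GrModel 𝕜 W p) x).source := by
    rw [hy, ← extChartAt_symm_apply]
    exact (extChartAt 𝓘(ℝ, GrModel 𝕜 W p) x).map_target (by rw [extChartAt_target]; trivial)
  have hyA : extChartAt 𝓘(ℝ, GrModel 𝕜 W p) x y = A := by
    rw [hy, ← extChartAt_symm_apply]
    exact (extChartAt 𝓘(ℝ, GrModel 𝕜 W p) x).right_inv (by rw [extChartAt_target]; trivial)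
  have h1 := mfderiv_coordField (I := 𝓘(ℝ, GrModel 𝕜 W p)) (x := x) (y := y)
    (by simpa using hsrc) (mdifferentiableAt_starProjection_plane y) v
  rw [starProjection_comp_extChartAt_symm, hyA, mfderiv_starProjection_plane] at h1
  have hcs : x.coordS s = c := by
    rw [← hc, map_add, coordS_frame, coordS_coframe, add_zero]
  have h2 := x.fderiv_graphProj_frame A v c
  rw [hc, ← h1] at h2
  refine (y.fderiv_graphProj_zero_apply _ s).symm.trans (h2.trans ?_)
  subst hy
  rw [← hcs]
  rfl

theorem metricDeriv_eq_zero (x : Gr 𝕜 W p) (u v w : TangentSpace 𝓘(ℝ, GrModel 𝕜 W p) x) :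
    metricDeriv 𝓘(ℝ, GrModel 𝕜 W p) x u v w = 0 := by
  set g : Gr 𝕜 W p → ℝ := fun y => inner ℝ (coordField 𝓘(ℝ, GrModel 𝕜 W p) x v y)
    (coordField 𝓘(ℝ, GrModel 𝕜 W p) x w y) with hg
  change mfderiv 𝓘(ℝ, GrModel 𝕜 W p) 𝓘(ℝ, ℝ) g x u = 0
  -- If differentiability fails, `mfderiv` is zero by default, so the smoothness of the coefficient
  -- need not be established.
  by_cases hd : MDifferentiableAt 𝓘(ℝ, GrModel 𝕜 W p) 𝓘(ℝ, ℝ) g x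
  · have h1 (A : GrModel 𝕜 W p) : g (mk (x.graphFrame A)) = RCLike.re (LinearMap.trace 𝕜 W
        ((x.homExt v : W →ₗ[𝕜] W).adjoint ∘ₗ
        (LinearMap.id - (x.graphProj A : W →ₗ[𝕜] W)) ∘ₗ
          (x.homExt w : W →ₗ[𝕜] W) ∘ₗ (x.graphProj A : W →ₗ[𝕜] W))) :=
      fubiniStudyInner_eq_trace _ (x.coe_tangentToHom_coordField v A rfl)
        (x.coe_tangentToHom_coordField w A rfl)
    rw [mfderiv_eq_fderiv_comp_extChartAt_symm hd, extChartAt_self, fderiv_zero_of_even]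
    · rfl
    · intro A
      simp only [Function.comp_apply, extChartAt_symm_apply, h1]
      exact congrArg RCLike.re (x.trace_homExt_graphProj_neg v w A)
  · rw [mfderiv_zero_of_not_mdifferentiableAt hd]
    rfl

/-- The Christoffel symbols of a graph chart vanish at its centre. -/
theorem christoffel_eq_zero (x : Gr 𝕜 W p) (u v : TangentSpace 𝓘(ℝ, GrModel 𝕜 W p) x) :
    christoffel 𝓘(ℝ, GrModel 𝕜 W p) x u v = 0 := by
  simp [christoffel, metricDeriv_eq_zero]

end Derivatives

end Gr

/-! ### Chart expressions near a point and their restriction to lines. -/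

section Charts

variable {E : Type*} [NormedAddCommGroup E] [NormedSpace ℝ E]
  {H : Type*} [TopologicalSpace H] {I : ModelWithCorners ℝ E H} [I.Boundaryless]
  {M : Type*} [TopologicalSpace M] [ChartedSpace H M] [IsManifold I ∞ M]
  {V : Type*} [NormedAddCommGroup V] [NormedSpace ℝ V]

theorem mfderiv_of_eventuallyEq_comp_extChartAt {k : M → V} {h : E → V} {x : M}
    (hk : k =ᶠ[𝓝 x] h ∘ extChartAt I x) (hh : DifferentiableAt ℝ h (extChartAt I x x))
    (u : TangentSpace I x) :
    mfderiv I 𝓘(ℝ, V) k x u = fderiv ℝ h (extChartAt I x x) u := by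
  have hd : MDifferentiableAt I 𝓘(ℝ, V) k x :=
    (hh.mdifferentiableAt.comp x
      (mdifferentiableAt_extChartAt (mem_chart_source H x))).congr_of_eventuallyEq hk
  rw [mfderiv_eq_fderiv_comp_extChartAt_symm hd]
  have hs : k ∘ (extChartAt I x).symm =ᶠ[𝓝 (extChartAt I x x)] h := by
    have h1 := (continuousAt_extChartAt_symm (I := I) x).tendsto
    rw [(extChartAt I x).left_inv (mem_extChartAt_source x)] at h1
    filter_upwards [h1.eventually hk, extChartAt_target_mem_nhds (I := I) x] with a ha hat
    rw [Function.comp_apply, ha, Function.comp_apply, (extChartAt I x).right_inv hat]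
  rw [hs.fderiv_eq]

omit [IsManifold I ∞ M] in
theorem ContMDiffAt.contDiffAt_comp_extChartAt_symm {g : M → V} {x : M} {n : ℕ∞ω}
    (hg : ContMDiffAt I 𝓘(ℝ, V) n g x) :
    ContDiffAt ℝ n (g ∘ (extChartAt I x).symm) (extChartAt I x x) := by
  have h := (contMDiffAt_iff.1 hg).2
  rwa [I.range_eq_univ, contDiffWithinAt_univ] at h

end Charts

section Lines

variable {E V : Type*} [NormedAddCommGroup E] [NormedSpace ℝ E] [NormedAddCommGroup V]
  [NormedSpace ℝ V] {F : E → V} {a : E}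

theorem HasFDerivAt.hasDerivAt_line {F' : E →L[ℝ] V} (hF : HasFDerivAt F F' a) (u : E) :
    HasDerivAt (fun s : ℝ => F (a + s • u)) (F' u) 0 :=
  hF.comp_hasDerivAt_of_eq (0 : ℝ)
    (by simpa using ((hasDerivAt_id (0 : ℝ)).smul_const u).const_add a) (by simp)

theorem ContDiffAt.eventually_hasDerivAt_line (hF : ContDiffAt ℝ ∞ F a) (u : E) :
    ∀ᶠ s : ℝ in 𝓝 0, HasDerivAt (fun s : ℝ => F (a + s • u)) (fderiv ℝ F (a + s • u) u) s := by
  have hd : ∀ᶠ b in 𝓝 a, DifferentiableAt ℝ F b :=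
    ((hF.of_le (m := 1) (by norm_cast)).eventually (by decide)).mono
      fun b hb => hb.differentiableAt (by simp)
  have hl : Filter.Tendsto (fun s : ℝ => a + s • u) (𝓝 0) (𝓝 a) := by
    have : Continuous fun s : ℝ => a + s • u := by fun_prop
    simpa using this.tendsto 0
  filter_upwards [hl.eventually hd] with s hs
  exact hs.hasFDerivAt.comp_hasDerivAt s
    (by simpa using ((hasDerivAt_id s).smul_const u).const_add a)

theorem ContDiffAt.hasFDerivAt_fderiv_apply (hF : ContDiffAt ℝ ∞ F a) (u : E) :
    HasFDerivAt (fun b => fderiv ℝ F b u)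
      ((ContinuousLinearMap.apply ℝ V u) ∘L fderiv ℝ (fderiv ℝ F) a) a := by
  have h : DifferentiableAt ℝ (fderiv ℝ F) a :=
    (hF.fderiv_right (m := 1) (by norm_cast)).differentiableAt (by simp)
  exact (ContinuousLinearMap.apply ℝ V u).hasFDerivAt.comp a h.hasFDerivAt

theorem ContDiffAt.differentiableAt_fderiv_apply (hF : ContDiffAt ℝ ∞ F a) (u : E) :
    DifferentiableAt ℝ (fun b => fderiv ℝ F b u) a :=
  (hF.hasFDerivAt_fderiv_apply u).differentiableAt

theorem ContDiffAt.hasDerivAt_fderiv_line (hF : ContDiffAt ℝ ∞ F a) (u : E) :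
    HasDerivAt (fun s : ℝ => fderiv ℝ F (a + s • u) u) (fderiv ℝ (fderiv ℝ F) a u u) 0 :=
  (hF.hasFDerivAt_fderiv_apply u).hasDerivAt_line u

end Lines

section Curves

variable {𝕜 W : Type*} [RCLike 𝕜] [NormedAddCommGroup W] [InnerProductSpace 𝕜 W]
  [NormedSpace ℝ W] [IsScalarTower ℝ 𝕜 W]

theorem DifferentiableAt.clm_apply_restrictScalars {E : Type*} [NormedAddCommGroup E]
    [NormedSpace ℝ E] {α : E → W →L[𝕜] W} {β : E → W} {a : E} (hα : DifferentiableAt ℝ α a)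
    (hβ : DifferentiableAt ℝ β a) : DifferentiableAt ℝ (fun a => α a (β a)) a :=
  DifferentiableAt.clm_apply (c := fun s => (α s).restrictScalars ℝ)
    ((ContinuousLinearMap.restrictScalarsL 𝕜 W W ℝ ℝ).differentiableAt.comp a hα) hβ

end Curves

/-! ### The composition `H K` in terms of the derivative of the projection. -/

namespace Gr

variable {𝕜 W : Type*} [RCLike 𝕜] [NormedAddCommGroup W] [InnerProductSpace 𝕜 W]
  [NormedSpace ℝ W] [IsScalarTower ℝ 𝕜 W] [FiniteDimensional 𝕜 W] {p : ℕ}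

theorem fderiv_graphProj_zero_sub (x : Gr 𝕜 W p) (X : GrModel 𝕜 W p) (w : W) :
    fderiv ℝ x.graphProj 0 X w - x.plane.starProjection (fderiv ℝ x.graphProj 0 X w) =
      x.homExt X w := by
  have h := x.fderiv_graphProj_idem 0 X w
  rw [graphProj_zero, fderiv_graphProj_zero_plane] at h
  exact sub_eq_of_eq_add h.symm

omit [NormedSpace ℝ W] [IsScalarTower ℝ 𝕜 W] in
theorem homExt_homExt (x : Gr 𝕜 W p) (X Y : GrModel 𝕜 W p) (w : W) :
    x.homExt X (x.homExt Y w) = 0 := by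
  rw [← homExt_starProjection, starProjection_homExt, map_zero]

/-- Replacing `w` by its `Q_x`-part changes the derivative of the projection by a vector of `Q_x`,
which `homExt` annihilates. -/
theorem coe_secondFormH_secondFormK (x : Gr 𝕜 W p) (X : GrModel 𝕜 W p) (w : W) :
    (x.secondFormH X (x.secondFormK X ((x.plane)ᗮ.orthogonalProjectionOnto w)) : W) =
      -x.homExt X (fderiv ℝ x.graphProj 0 X w) := by
  have h1 : (((x.plane)ᗮ.orthogonalProjectionOnto w : (x.plane)ᗮ) : W) =
      w - x.plane.starProjection w := Submodule.starProjection_orthogonal_val w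
  refine (x.coe_secondFormH X _).trans ?_
  refine (congrArg (x.homExt X) (x.coe_secondFormK X _)).trans ?_
  rw [h1, map_neg, map_sub, fderiv_graphProj_zero_plane, map_sub, homExt_homExt, sub_zero]

end Gr

/-! ### Covariant derivatives and Laplacian of the sections defined by vectors of `W`. -/

section Pullback

variable {𝕜 W : Type*} [RCLike 𝕜] [NormedAddCommGroup W] [InnerProductSpace 𝕜 W]
  [NormedSpace ℝ W] [IsScalarTower ℝ 𝕜 W] [FiniteDimensional 𝕜 W] {p : ℕ}
  {E : Type*} [NormedAddCommGroup E] [NormedSpace ℝ E]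
  {H : Type*} [TopologicalSpace H] {I : ModelWithCorners ℝ E H}
  {M : Type*} [TopologicalSpace M] [ChartedSpace H M]

/-- The orthogonal projections to the planes of a map to the Grassmannian. -/
noncomputable def planeProj (f : M → Gr 𝕜 W p) (y : M) : W →L[𝕜] W :=
  (f y).plane.starProjection

variable {f : M → Gr 𝕜 W p} (hf : ContMDiff I 𝓘(ℝ, GrModel 𝕜 W p) ∞ f)
include hf

theorem contMDiff_planeProj : ContMDiff I 𝓘(ℝ, W →L[𝕜] W) ∞ (planeProj f) :=
  Gr.contMDiff_starProjection_plane.comp hf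

theorem mfderiv_planeProj (x : M) (u : TangentSpace I x) :
    mfderiv I 𝓘(ℝ, W →L[𝕜] W) (planeProj f) x u =
      fderiv ℝ (f x).graphProj 0 (mfderiv I 𝓘(ℝ, GrModel 𝕜 W p) f x u) :=
  (mfderiv_comp_apply x (Gr.mdifferentiableAt_starProjection_plane (f x))
    (hf.mdifferentiableAt (by simp)) u).trans (Gr.mfderiv_starProjection_plane _ _)

/-- The operator `T` is left free because the derivative of the projection is used in two forms: in
the chart of `M` at a nearby point, and in the graph chart centred at `f y`. -/
theorem coe_connection_sectionOf (w : W) (y : M) (u : TangentSpace I y) {T : W →L[𝕜] W}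
    (hT : mfderiv I 𝓘(ℝ, W →L[𝕜] W) (planeProj f) y u = T) :
    (connection I f (sectionOf f w) y u : W) = (f y).plane.starProjection (T w) - T w := by
  have h1 : (fun y => (sectionOf f w y : W)) = (fun T : W →L[𝕜] W => w - T w) ∘ planeProj f :=
    funext fun y => Submodule.starProjection_orthogonal_val w
  let L : (W →L[𝕜] W) →L[ℝ] W := (ContinuousLinearMap.apply 𝕜 W w).restrictScalars ℝ
  have hL (T : W →L[𝕜] W) : HasFDerivAt (fun T : W →L[𝕜] W => w - T w) (-L) T :=
    L.hasFDerivAt.const_sub w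
  have h2 : mfderiv I 𝓘(ℝ, W) (fun y => (sectionOf f w y : W)) y u = -T w := by
    rw [h1, ← hT]
    refine (mfderiv_comp_apply y (hL _).differentiableAt.mdifferentiableAt
      ((contMDiff_planeProj hf).mdifferentiableAt (by simp)) u).trans ?_
    rw [mfderiv_eq_fderiv, (hL _).fderiv]
    rfl
  have h3 : (connection I f (sectionOf f w) y u : W) = ((f y).plane)ᗮ.starProjection
      (mfderiv I 𝓘(ℝ, W) (fun y => (sectionOf f w y : W)) y u) := rfl
  rw [h3, h2, Submodule.starProjection_orthogonal_val, map_neg]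
  abel

variable [I.Boundaryless]

omit [NormedSpace ℝ W] [IsScalarTower ℝ 𝕜 W] in
theorem contDiffAt_writtenInExtChartAt (x : M) :
    ContDiffAt ℝ ∞ (writtenInExtChartAt I 𝓘(ℝ, GrModel 𝕜 W p) x f) (extChartAt I x x) := by
  have h := (contMDiffAt_iff.1 (hf x)).2
  rwa [I.range_eq_univ, contDiffWithinAt_univ] at h

omit [NormedSpace ℝ W] [IsScalarTower ℝ 𝕜 W] [I.Boundaryless] in
theorem planeProj_comp_extChartAt_symm (x : M) :
    planeProj f ∘ (extChartAt I x).symm =ᶠ[𝓝 (extChartAt I x x)]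
      (f x).graphProj ∘ writtenInExtChartAt I 𝓘(ℝ, GrModel 𝕜 W p) x f := by
  have h1 := (continuousAt_extChartAt_symm (I := I) x).tendsto
  rw [(extChartAt I x).left_inv (mem_extChartAt_source x)] at h1
  filter_upwards [h1.eventually (hf.continuous.continuousAt.eventually
    (extChartAt_source_mem_nhds (I := 𝓘(ℝ, GrModel 𝕜 W p)) (f x)))] with a ha
  rw [Function.comp_apply, Function.comp_apply, ← Gr.starProjection_comp_extChartAt_symm,
    Function.comp_apply, writtenInExtChartAt, Function.comp_apply, Function.comp_apply,
    (extChartAt 𝓘(ℝ, GrModel 𝕜 W p) (f x)).left_inv ha]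
  rfl

/-- The second covariant derivative of the section `t` defined by a vector `w`, before the
correction by the Christoffel symbols of `M`. -/
theorem coe_connection_connection_sectionOf [IsManifold I ∞ M] (w : W) (x : M)
    (u : TangentSpace I x) :
    (connection I f (fun y => connection I f (sectionOf f w) y (coordField I x u y)) x u : W) =
      -(f x).homExt (coordHessian I 𝓘(ℝ, GrModel 𝕜 W p) f x u u) w -
        (f x).homExt (mfderiv I 𝓘(ℝ, GrModel 𝕜 W p) f x u)
          (fderiv ℝ (f x).graphProj 0 (mfderiv I 𝓘(ℝ, GrModel 𝕜 W p) f x u) w) := by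
  set F := planeProj f ∘ (extChartAt I x).symm with hF
  set φ := writtenInExtChartAt I 𝓘(ℝ, GrModel 𝕜 W p) x f with hφ
  set a := extChartAt I x x with ha
  let u' : E := u
  have hFc : ContDiffAt ℝ ∞ F a := (contMDiff_planeProj hf x).contDiffAt_comp_extChartAt_symm
  have hφc : ContDiffAt ℝ ∞ φ a := contDiffAt_writtenInExtChartAt hf x
  -- The second derivative is only needed on the diagonal, so a straight line in the chart of `M`
  -- suffices.
  let l : ℝ → E := fun s => a + s • u'
  have hl0 : l 0 = a := by simp [l]
  have hlt : Filter.Tendsto l (𝓝 0) (𝓝 a) := by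
    have hl : Continuous l := by fun_prop
    simpa only [hl0] using hl.tendsto 0
  have hαF : ∀ᶠ s in 𝓝 0, HasDerivAt (fun s => F (l s)) (fderiv ℝ F (l s) u') s :=
    hFc.eventually_hasDerivAt_line u'
  have hα₁ : HasDerivAt (fun s => fderiv ℝ F (l s) u') (fderiv ℝ (fderiv ℝ F) a u' u') 0 :=
    hFc.hasDerivAt_fderiv_line u'
  have hγ : ∀ᶠ s in 𝓝 0, HasDerivAt (fun s => φ (l s)) (fderiv ℝ φ (l s) u') s :=
    hφc.eventually_hasDerivAt_line u'
  have hγ₁ : HasDerivAt (fun s => fderiv ℝ φ (l s) u') (fderiv ℝ (fderiv ℝ φ) a u' u') 0 :=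
    hφc.hasDerivAt_fderiv_line u'
  have hα : ∀ᶠ s in 𝓝 0,
      HasDerivAt (fun s => (f x).graphProj (φ (l s))) (fderiv ℝ F (l s) u') s := by
    have h1 := hlt.eventually (planeProj_comp_extChartAt_symm hf x)
    filter_upwards [hαF, h1.eventually_nhds] with s hs hs'
    exact hs.congr_of_eventuallyEq (hs'.mono fun r hr => hr.symm)
  have h0 : φ (l 0) = 0 := by
    rw [hl0, hφ, ha, writtenInExtChartAt, Function.comp_apply, Function.comp_apply,
      (extChartAt I x).left_inv (mem_extChartAt_source x), Gr.extChartAt_self]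
  have hF0 : F a = (f x).plane.starProjection := by
    rw [hF, ha, Function.comp_apply, (extChartAt I x).left_inv (mem_extChartAt_source x)]
    rfl
  have hD : fderiv ℝ F a u' = fderiv ℝ (f x).graphProj 0
      (mfderiv I 𝓘(ℝ, GrModel 𝕜 W p) f x u) := by
    rw [← mfderiv_planeProj hf, mfderiv_eq_fderiv_comp_extChartAt_symm
      ((contMDiff_planeProj hf).mdifferentiableAt (by simp))]
  have hsecond := Gr.second_deriv_graphProj h0 hγ hγ₁ hα hα₁ w
  -- The chart expression of `∇_{∂_u} t`, namely `-(1 - P) P'_u w`.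
  let h : E → W := fun b => F b (fderiv ℝ F b u' w) - fderiv ℝ F b u' w
  have hFuw : DifferentiableAt ℝ (fun b => fderiv ℝ F b u' w) a :=
    (hFc.differentiableAt_fderiv_apply u').clm_apply_restrictScalars (differentiableAt_const w)
  have hh : DifferentiableAt ℝ h a :=
    ((hFc.differentiableAt (by simp)).clm_apply_restrictScalars hFuw).sub hFuw
  have hk : (fun y => (connection I f (sectionOf f w) y (coordField I x u y) : W)) =ᶠ[𝓝 x]
      h ∘ extChartAt I x := by
    filter_upwards [chart_source_mem_nhds H x] with y hy
    rw [coe_connection_sectionOf hf w y _ (mfderiv_coordField hy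
      ((contMDiff_planeProj hf).mdifferentiableAt (by simp)) u), Function.comp_apply]
    have hFy : F (extChartAt I x y) = (f y).plane.starProjection := by
      rw [hF, Function.comp_apply, (extChartAt I x).left_inv (by simpa using hy)]
      rfl
    change _ = F (extChartAt I x y) _ - _
    rw [hFy]
  have hhu : fderiv ℝ h a u' =
      (fderiv ℝ F a u' (fderiv ℝ F a u' w) +
        (f x).plane.starProjection (fderiv ℝ (fderiv ℝ F) a u' u' w)) -
          fderiv ℝ (fderiv ℝ F) a u' u' w := by
    have h1 : HasDerivAt (fun s => h (l s)) (fderiv ℝ h a u') 0 := hh.hasFDerivAt.hasDerivAt_line u'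
    have h2 := (hαF.self_of_nhds.clm_apply_restrictScalars (hα₁.clm_apply_const w)).sub
      (hα₁.clm_apply_const w)
    rw [hl0, hF0] at h2
    exact h1.unique h2
  have hcoe : (connection I f
      (fun y => connection I f (sectionOf f w) y (coordField I x u y)) x u : W) =
      ((f x).plane)ᗮ.starProjection (fderiv ℝ h a u') := by
    rw [← mfderiv_of_eventuallyEq_comp_extChartAt hk hh]
    rfl
  have hPP (v : W) : (f x).plane.starProjection ((f x).plane.starProjection v) =
      (f x).plane.starProjection v :=
    Submodule.starProjection_eq_self_iff.2 (Submodule.starProjection_apply_mem _ v)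
  have hE (v : W) : fderiv ℝ F a u' v - (f x).plane.starProjection (fderiv ℝ F a u' v) =
      (f x).homExt (mfderiv I 𝓘(ℝ, GrModel 𝕜 W p) f x u) v := by
    rw [hD]
    exact (f x).fderiv_graphProj_zero_sub _ v
  rw [hl0, two_smul] at hsecond
  -- The projection to `Q` leaves one `(1 - P) P' P' w` and `-(1 - P) P'' w`; the latter contains
  -- `-2 (1 - P) P' P' w` by `hsecond`, so the net coefficient is `-1`.
  rw [hcoe, hhu, Submodule.starProjection_orthogonal_val, map_sub, map_add, hPP, ← hD, ← hE]
  have hH : coordHessian I 𝓘(ℝ, GrModel 𝕜 W p) f x u u = fderiv ℝ (fderiv ℝ φ) a u' u' := rfl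
  rw [hH, eq_sub_of_add_eq hsecond.symm]
  abel

variable [FiniteDimensional ℝ E] [IsManifold I ∞ M]
  [RiemannianBundle (fun x : M => TangentSpace I x)]

/-- The Grassmannian has no Christoffel term at the centre of its chart, and the Christoffel term of
`M` in the connection is exactly the one in `∇df`. -/
theorem coe_connectionHessian_sectionOf (w : W) (x : M) (u : TangentSpace I x) :
    (connectionHessian I f (sectionOf f w) x u u : W) =
      (((f x).secondFormH (mfderiv I 𝓘(ℝ, GrModel 𝕜 W p) f x u) ∘L
        (f x).secondFormK (mfderiv I 𝓘(ℝ, GrModel 𝕜 W p) f x u)) (sectionOf f w x) : W) -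
      (f x).homExt (secondFundamentalForm I 𝓘(ℝ, GrModel 𝕜 W p) f x u u) w := by
  have h1 := (f x).coe_secondFormH_secondFormK (mfderiv I 𝓘(ℝ, GrModel 𝕜 W p) f x u) w
  have h2 : (f x).homExt (secondFundamentalForm I 𝓘(ℝ, GrModel 𝕜 W p) f x u u) w =
      (f x).homExt (coordHessian I 𝓘(ℝ, GrModel 𝕜 W p) f x u u) w -
        (f x).homExt (mfderiv I 𝓘(ℝ, GrModel 𝕜 W p) f x (christoffel I x u u)) w := by
    rw [secondFundamentalForm, Gr.christoffel_eq_zero, add_zero]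
    exact congrArg (fun T : W →L[𝕜] W => T w) ((f x).homExt_sub _ _)
  have h3 : (connection I f (sectionOf f w) x (christoffel I x u u) : W) =
      -(f x).homExt (mfderiv I 𝓘(ℝ, GrModel 𝕜 W p) f x (christoffel I x u u)) w := by
    rw [coe_connection_sectionOf hf w x _ (mfderiv_planeProj hf x _)]
    exact (neg_sub _ _).symm.trans (congrArg Neg.neg ((f x).fderiv_graphProj_zero_sub _ w))
  rw [connectionHessian, Submodule.coe_sub, coe_connection_connection_sectionOf hf, h2, h3]
  refine Eq.trans ?_ (congrArg (· - _) h1.symm)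
  abel

/-- The Laplacian of the section of `f^*Q` defined by a vector. -/
theorem coe_laplacian_sectionOf (w : W) (x : M) :
    (laplacian I f (sectionOf f w) x : W) =
      (f x).homExt (tensionField I 𝓘(ℝ, GrModel 𝕜 W p) f x) w -
        (meanCurvatureOperator I f x (sectionOf f w x) : W) := by
  have h1 : (f x).homExt (tensionField I 𝓘(ℝ, GrModel 𝕜 W p) f x) w =
      ∑ i, (f x).homExt (secondFundamentalForm I 𝓘(ℝ, GrModel 𝕜 W p) f x
        (stdOrthonormalBasis ℝ (TangentSpace I x) i)
        (stdOrthonormalBasis ℝ (TangentSpace I x) i)) w := by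
    refine (congrArg (fun T : W →L[𝕜] W => T w) ((f x).homExt_sum _ _)).trans ?_
    simp
  rw [h1, laplacian, meanCurvatureOperator]
  simp only [sum_apply, Submodule.coe_neg, Submodule.coe_sum]
  rw [← Finset.sum_sub_distrib, ← Finset.sum_neg_distrib]
  refine Finset.sum_congr rfl fun i _ => ?_
  rw [coe_connectionHessian_sectionOf hf, neg_sub]

omit hf [I.Boundaryless] [IsManifold I ∞ M] in
-- Linear algebra in the vectors `df(e_i)` alone, so neither harmonicity nor smoothness enters.
theorem energyDensity_eq_neg_trace (f : M → Gr 𝕜 W p) (x : M) :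
    ((energyDensity I 𝓘(ℝ, GrModel 𝕜 W p) f x : ℝ) : 𝕜) =
      -LinearMap.trace 𝕜 ((f x).plane)ᗮ (meanCurvatureOperator I f x) := by
  rw [energyDensity, meanCurvatureOperator]
  simp only [ContinuousLinearMap.toLinearMap_sum, map_sum, Gr.trace_secondFormH_comp_secondFormK]
  simp

end Pullback

theorem mainTheorem1 {𝕜 W : Type*} [RCLike 𝕜] [NormedAddCommGroup W] [InnerProductSpace 𝕜 W]
    [NormedSpace ℝ W] [IsScalarTower ℝ 𝕜 W] [FiniteDimensional 𝕜 W] (p n : ℕ)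
    {M : Type*} [TopologicalSpace M] [ChartedSpace (EuclideanSpace ℝ (Fin n)) M]
    [IsManifold (𝓡 n) ∞ M]
    [RiemannianBundle (fun x : M => TangentSpace (𝓡 n) x)]
    [IsContMDiffRiemannianBundle (𝓡 n) ∞ (EuclideanSpace ℝ (Fin n))
      (fun x : M => TangentSpace (𝓡 n) x)]
    (f : M → Gr 𝕜 W p) (hf : ContMDiff (𝓡 n) 𝓘(ℝ, GrModel 𝕜 W p) ∞ f) :
    (IsHarmonicMap (𝓡 n) 𝓘(ℝ, GrModel 𝕜 W p) f ↔
      HasZeroProperty (𝓡 n) f (spaceOfSections f)) ∧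
    (IsHarmonicMap (𝓡 n) 𝓘(ℝ, GrModel 𝕜 W p) f →
      (∀ t ∈ spaceOfSections f, ∀ x : M,
        laplacian (𝓡 n) f t x = -meanCurvatureOperator (𝓡 n) f x (t x)) ∧
      ∀ x : M, ((energyDensity (𝓡 n) 𝓘(ℝ, GrModel 𝕜 W p) f x : ℝ) : 𝕜) =
        -LinearMap.trace 𝕜 ((f x).plane)ᗮ (meanCurvatureOperator (𝓡 n) f x)) := by
  have hlap (hharm : IsHarmonicMap (𝓡 n) 𝓘(ℝ, GrModel 𝕜 W p) f) (w : W) (x : M) :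
      laplacian (𝓡 n) f (sectionOf f w) x =
        -meanCurvatureOperator (𝓡 n) f x (sectionOf f w x) := by
    ext
    have h0 : (f x).homExt (tensionField (𝓡 n) 𝓘(ℝ, GrModel 𝕜 W p) f x) = 0 :=
      ((f x).homExt_eq_zero_iff _).2 (hharm x)
    rw [coe_laplacian_sectionOf hf, h0, zero_apply, zero_sub, Submodule.coe_neg]
  refine ⟨⟨?_, fun hzero x => ?_⟩, fun hharm => ⟨?_, fun x => energyDensity_eq_neg_trace f x⟩⟩
  · rintro hharm _ ⟨w, rfl⟩ x hx
    have hx' : sectionOf f w x = 0 := hx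
    change laplacian (𝓡 n) f (sectionOf f w) x = 0
    rw [hlap hharm, hx', map_zero, neg_zero]
  · refine ((f x).homExt_eq_zero_iff _).1 ?_
    ext w
    -- The section defined by the `S`-part of `w` vanishes at `x`, while `homExt` takes the same
    -- value on it as on `w`.
    set v := (f x).plane.starProjection w
    have hv : sectionOf f v x = 0 :=
      Submodule.orthogonalProjectionOnto_apply_of_mem_orthogonal
        (Submodule.le_orthogonal_orthogonal _ (Submodule.starProjection_apply_mem _ w))
    have hv' : laplacian (𝓡 n) f (sectionOf f v) x = 0 := hzero _ ⟨v, rfl⟩ hv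
    have h := coe_laplacian_sectionOf hf v x
    rw [hv', hv, map_zero, Submodule.coe_zero, sub_zero] at h
    exact ((f x).homExt_starProjection _ w).symm.trans h.symm
  · rintro _ ⟨w, rfl⟩ x
    exact hlap hharm w x
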